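/- **Theorem 1.4** ($L^\infty_TL^2_x\times L^\infty_TL^2_x$ convergence). For $0<\tau<1$ let $(u_{0\tau},v_{0\tau})\in H^1(\mathbb R;\mathbb C)\times H^1(\mathbb R;\mathbb R)$ and let $(u_\tau,v_\tau)\in C([0,\infty);H^1\times H^1)$ be the corresponding global solution of the focusing Schrödinger–Debye system $$i\partial_tu_\tau+\tfrac12\partial_x^2u_\tau=u_\tau v_\tau,\qquad \tau\partial_tv_\tau+v_\tau=-|u_\tau|^2,\qquad u_\tau(0)=u_{0\tau},\quad v_\tau(0)=v_{0\tau},\qquad x\in\mathbb R,\ t\ge0,$$ i.e., with $S(t)=e^{it\partial_x^2/2}$, $$u_\tau(t)=S(t)u_{0\tau}-i\int_0^tS(t-s)\,u_\tau(s)v_\tau(s)\,ds,\qquad v_\tau(t)=e^{-t/\tau}v_{0\tau}-\frac1\tau\int_0^te^{-(t-s)/\tau}|u_\tau(s)|^2\,ds .$$ Suppose that (i) $\lim_{\tau\to0}\|u_{0\tau}-u_0\|_{H^1}=0$ for some $u_0\in H^1(\mathbb R;\mathbb C)$, and that one of the following holds: (ii) $\sup_{0<\tau<1}\|v_{0\tau}\|_{L^2}<\infty$;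 or (iii) $\|v_{0\tau}\|_{L^2}=O(\tau^{-1+\gamma})$ as $\tau\to0$ for some $\gamma>0$, and $\sup_{0<\tau<1}E_\tau(0)\le0$, where $E_\tau(0)=\int_{\mathbb R}\big(|\partial_xu_{0\tau}|^2+2v_{0\tau}|u_{0\tau}|^2+v_{0\tau}^2\big)\,dx$. Let $u\in C([0,\infty);L^2)\cap L^4_{loc}([0,\infty);L^\infty)$ be the global $L^2$-solution of the focusing cubic Schrödinger equation $i\partial_tu+\frac12\partial_x^2u=-|u|^2u$, $u(0)=u_0$, i.e. $u(t)=S(t)u_0+i\int_0^tS(t-s)\,|u(s)|^2u(s)\,ds$. Write $\|F\|_{L^\infty_{T}L^2_x}=\sup_{t\in[0,T]}\|F(t)\|_{L^2(\mathbb R)}$. Then, for all $T^*>0$, $$\lim_{\tau\to0}\|u_\tau-u\|_{L^\infty_{T^*}L^2_x}=0\qquad\text{and}\qquad\lim_{\tau\to0}\big\|v_\tau+|u|^2-e^{-t/\tau}(v_{0\tau}+|u_0|^2)\big\|_{L^\infty_{T^*}L^2_x}=0 .$$ Moreover, if $\lim_{\tau\to0}\big\|v_{0\tau}+|u_0|^2\big\|_{L^2}=0$,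 then $$\lim_{\tau\to0}\big\|v_\tau+|u|^2\big\|_{L^\infty_{T^*}L^2_x}=0 .$$ -/

import Mathlib

open MeasureTheory Set Filter Topology Asymptotics
open scoped ENNReal ContDiff FourierTransform

noncomputable section

/-- The Lebesgue space `L²(ℝ; 𝕜)` of the line (`𝕜 = ℝ` or `ℂ`). -/
abbrev L2 (𝕜 : Type) [RCLike 𝕜] : Type := Lp 𝕜 2 (volume : Measure ℝ)

/-- `g` is the weak derivative of `f`: `∫ φ' f = - ∫ φ g` for all test functions `φ`. -/
def HasWeakDeriv {𝕜 : Type} [RCLike 𝕜] (f g : L2 𝕜) : Prop :=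
  ∀ φ : ℝ → ℝ, ContDiff ℝ ∞ φ → HasCompactSupport φ →
    ∫ x, deriv φ x • f x = - ∫ x, φ x • g x

theorem integrable_testFunction_smul {𝕜 : Type} [RCLike 𝕜] {φ : ℝ → ℝ} (hφ : Continuous φ)
    (hc : HasCompactSupport φ) (f : L2 𝕜) : Integrable (fun x => φ x • f x) := by
  have h1 : MemLp φ 2 (volume : Measure ℝ) := hφ.memLp_of_hasCompactSupport hc
  exact memLp_one_iff_integrable.1 ((Lp.memLp f).smul h1)

theorem HasWeakDeriv.add {𝕜 : Type} [RCLike 𝕜] {f f' g g' : L2 𝕜} (hf : HasWeakDeriv f f')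
    (hg : HasWeakDeriv g g') : HasWeakDeriv (f + g) (f' + g') := by
  intro φ hφ hc
  have hd : Continuous (deriv φ) := hφ.continuous_deriv (by simp)
  have e1 : ∫ x, deriv φ x • (f + g : L2 𝕜) x = ∫ x, (deriv φ x • f x + deriv φ x • g x) := by
    refine integral_congr_ae ?_
    filter_upwards [Lp.coeFn_add f g] with x hx
    rw [hx, Pi.add_apply, smul_add]
  have e2 : ∫ x, φ x • (f' + g' : L2 𝕜) x = ∫ x, (φ x • f' x + φ x • g' x) := by
    refine integral_congr_ae ?_
    filter_upwards [Lp.coeFn_add f' g'] with x hx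
    rw [hx, Pi.add_apply, smul_add]
  rw [e1, e2, integral_add (integrable_testFunction_smul hd hc.deriv f)
    (integrable_testFunction_smul hd hc.deriv g),
    integral_add (integrable_testFunction_smul hφ.continuous hc f')
    (integrable_testFunction_smul hφ.continuous hc g'), hf φ hφ hc, hg φ hφ hc]
  ring

theorem HasWeakDeriv.smul {𝕜 : Type} [RCLike 𝕜] (c : 𝕜) {f f' : L2 𝕜}
    (hf : HasWeakDeriv f f') : HasWeakDeriv (c • f) (c • f') := by
  intro φ hφ hc
  have e1 : ∫ x, deriv φ x • (c • f : L2 𝕜) x = ∫ x, c • (deriv φ x • f x) := by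
    refine integral_congr_ae ?_
    filter_upwards [Lp.coeFn_smul c f] with x hx
    rw [hx, Pi.smul_apply, smul_comm]
  have e2 : ∫ x, φ x • (c • f' : L2 𝕜) x = ∫ x, c • (φ x • f' x) := by
    refine integral_congr_ae ?_
    filter_upwards [Lp.coeFn_smul c f'] with x hx
    rw [hx, Pi.smul_apply, smul_comm]
  rw [e1, e2, integral_smul, integral_smul, hf φ hφ hc, smul_neg]

theorem HasWeakDeriv.zero {𝕜 : Type} [RCLike 𝕜] : HasWeakDeriv (0 : L2 𝕜) 0 := by
  intro φ _ _
  simp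

/-- The Sobolev space `H¹(ℝ; 𝕜)` as a subspace of `L² × L²`: the pairs `(f, ∂ₓf)`. -/
def sobolevSubmodule (𝕜 : Type) [RCLike 𝕜] : Submodule 𝕜 (WithLp 2 (L2 𝕜 × L2 𝕜)) where
  carrier := {p | HasWeakDeriv p.fst p.snd}
  add_mem' := fun ha hb => ha.add hb
  zero_mem' := HasWeakDeriv.zero
  smul_mem' := fun c _ hp => HasWeakDeriv.smul c hp

/-- The Sobolev space `H¹(ℝ; 𝕜)`, as the space of pairs `(f, ∂ₓf)` in `L² × L²`, with the norm
`(‖f‖² + ‖∂ₓf‖²)^{1/2}` (inherited from the `ℓ²`-product `L² × L²`). -/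
abbrev H1 (𝕜 : Type) [RCLike 𝕜] : Type := sobolevSubmodule 𝕜

/-- The function underlying an element of `H¹`. -/
def H1.fn {𝕜 : Type} [RCLike 𝕜] (f : H1 𝕜) : L2 𝕜 := f.1.fst

/-- The weak derivative `∂ₓf` of an element `f` of `H¹`. -/
def H1.dx {𝕜 : Type} [RCLike 𝕜] (f : H1 𝕜) : L2 𝕜 := f.1.snd

open Classical in
/-- The class in `L²` of a square integrable function (and `0` for any other function). -/
def toL2 {𝕜 : Type} [RCLike 𝕜] (f : ℝ → 𝕜) : L2 𝕜 :=
  if h : MemLp f 2 volume then h.toLp f else 0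

theorem memLp_schrodingerSymbol_mul (t : ℝ) (g : L2 ℂ) :
    MemLp (fun ξ : ℝ => Complex.exp ((-(2 * Real.pi ^ 2 * t * ξ ^ 2) : ℝ) * Complex.I) * g ξ)
      2 volume := by
  refine (Lp.memLp g).of_le ?_ (Eventually.of_forall fun ξ => ?_)
  · exact (Continuous.aestronglyMeasurable (by fun_prop)).mul (Lp.aestronglyMeasurable g)
  · rw [norm_mul, Complex.norm_exp_ofReal_mul_I, one_mul]

/-- The free Schrödinger group `S(t) = e^{i t ∂ₓ² / 2}` on `L²(ℝ; ℂ)`, as a Fourier multiplier.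
With `𝓕 f (ξ) = ∫ e^{-2πixξ} f(x) dx` the operator `∂ₓ²` has symbol `-(2πξ)²`, so that `S(t)` has
symbol `e^{-2π² i t ξ²}`. -/
def schrodingerGroup (t : ℝ) (f : L2 ℂ) : L2 ℂ :=
  𝓕⁻ ((memLp_schrodingerSymbol_mul t (𝓕 f)).toLp _)

/-- `(u, v) ∈ C([0,∞); H¹ × H¹)` is the global solution of the Schrödinger-Debye system
`i ∂ₜu + ½ ∂ₓ²u = u v`, `τ ∂ₜv + v = lam |u|²` with initial data `(u₀, v₀)`,
in integral (Duhamel) form. Since `H¹(ℝ)` is an algebra contained in `L²`, the integrands are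
continuous functions of `s` with values in `L²`. -/
structure IsSDSolution (lam τ : ℝ) (u₀ : H1 ℂ) (v₀ : H1 ℝ) (u : ℝ → H1 ℂ) (v : ℝ → H1 ℝ) :
    Prop where
  continuousOn_u : ContinuousOn u (Ici 0)
  continuousOn_v : ContinuousOn v (Ici 0)
  eq_u : ∀ t : ℝ, 0 ≤ t → (u t).fn = schrodingerGroup t u₀.fn
    - Complex.I • ∫ s in (0 : ℝ)..t,
        schrodingerGroup (t - s) (toL2 fun x => (u s).fn x * ((v s).fn x : ℂ))
  eq_v : ∀ t : ℝ, 0 ≤ t → (v t).fn = Real.exp (-t / τ) • v₀.fn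
    + (lam / τ) • ∫ s in (0 : ℝ)..t,
        Real.exp (-(t - s) / τ) • toL2 fun x => ‖(u s).fn x‖ ^ 2

/-- `u` is the global `L²`-solution of the cubic Schrödinger equation
`i ∂ₜu + ½ ∂ₓ²u = lam |u|² u` with initial data `u₀ ∈ L²`: it belongs to
`C([0,∞); L²) ∩ L⁴_loc([0,∞); L^∞)`, the class of the `L²` well-posedness theory, and satisfies
the equation in integral (Duhamel) form. Note that `|u|² u ∈ L²_loc([0,∞); L²)`. -/
structure IsNLSSolution (lam : ℝ) (u₀ : L2 ℂ) (u : ℝ → L2 ℂ) : Prop where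
  continuousOn : ContinuousOn u (Ici 0)
  strichartz : ∀ T : ℝ, ∫⁻ t in Icc 0 T, eLpNorm (u t) ⊤ volume ^ 4 < ⊤
  intervalIntegrable : ∀ t : ℝ, 0 ≤ t → IntervalIntegrable
    (fun s => schrodingerGroup (t - s) (toL2 fun x => lam * (‖u s x‖ : ℂ) ^ 2 * u s x))
    volume 0 t
  eq_u : ∀ t : ℝ, 0 ≤ t → u t = schrodingerGroup t u₀
    - Complex.I • ∫ s in (0 : ℝ)..t,
        schrodingerGroup (t - s) (toL2 fun x => lam * (‖u s x‖ : ℂ) ^ 2 * u s x)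

/-- The energy `∫ (|∂ₓu|² + 2 v |u|² - lam v²) dx` of a state `(u, v) ∈ H¹ × H¹` of the
Schrödinger-Debye system. -/
def sdEnergy (lam : ℝ) (u : H1 ℂ) (v : H1 ℝ) : ℝ :=
  ∫ x, (‖u.dx x‖ ^ 2 + 2 * v.fn x * ‖u.fn x‖ ^ 2 - lam * v.fn x ^ 2)

/-- The norm `sup_{t ∈ [0,T]} ‖F(t, ·)‖_{L²}` of `L^∞([0,T]; L²(ℝ))`, with values in `[0,∞]`. -/
def normLinftyL2 {𝕜 : Type} [RCLike 𝕜] (T : ℝ) (F : ℝ → ℝ → 𝕜) : ℝ≥0∞ :=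
  ⨆ t ∈ Icc (0 : ℝ) T, eLpNorm (F t) 2 volume

end

/-!
The proof is an energy argument; dispersion enters only through the class of the limit solution.

*Uniform bounds.* The focusing Schrödinger-Debye system conserves `‖u‖_{L²}`, and its energy
`∫ (|∂ₓu|² + 2 v |u|² + v²) dx` decreases at the rate `2 τ⁻¹ ‖v + |u|²‖²_{L²}`. At fixed mass the
energy is coercive, because `H¹ ⊂ L^∞` bounds `∫ |u|⁴` by a polynomial in the mass and a small part
of `‖∂ₓu‖²`. Hence a nonpositive initial energy already bounds `v₀τ` in `L²`, and both alternatives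
for the data lead to one bound `‖u_τ(t)‖_{L^∞} ≤ M`, uniform in `t` and in small `τ`
(`exists_forall_isSDSolution_ae_norm_le`). The solutions satisfy only the integral equation, so the
energy law cannot be obtained by inserting `∂ₜu ∈ L²`. The masses of `u` and of `∂ₓu` are
differentiated in the interaction picture `S(-t) u(t)`, which is `C¹` in `L²`; the interaction
energy `∫ v |u|²` is differentiated from the right, with the generator of `S` in the weak form
`h⁻¹ ⟪g, (S(h) - 1) f⟫ → -(i/2) ⟪∂ₓg, ∂ₓf⟫` for `f, g ∈ H¹`.

*Convergence of `u_τ`.* The nonlinear terms differ by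
`u_τ v_τ + |u|² u = u_τ (v_τ + |u|²) - |u|² (u_τ - u)`. By the formula for `v_τ`,
`v_τ(r) + |u(r)|²` is the initial layer `e^{-r/τ} (v₀τ + |u(r)|²)` minus the average of
`|u_τ(s)|² - |u(r)|²` over `s ≤ r` with the weight `τ⁻¹ e^{-(r-s)/τ}`
(`IsSDSolution.norm_relaxation_le`). The layer is negligible in `L¹` in time. In the average,
`u_τ(s) - u(r)` is `u_τ(s) - u(s)` up to `u(s) - u(r)`, which is at most `δ + c (r - s)` by
continuity. Duhamel's formula thus gives a Gronwall inequality for `‖u_τ - u‖_{L²}` with the kernel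
`M (M + q) + q²`, where `q(t) = ‖u(t)‖_{L^∞}` is locally in `L²` in time. It is solved by taking the
maximum with a weight `e^{-Lt}`, with `L` so large that the feedback has coefficient at most `1/2`
(`IsSDSolution.norm_fn_sub_le`).

*Convergence of `v_τ`.* The bound `M` passes to the limit `u`. So `u ↦ |u|²` is Lipschitz in `L²`
along all the solutions, and the formula for `v_τ`, compared with `|u(t)|²`, gives the claim up to
`e^{-t/τ} (|u(t)|² - |u₀|²)`, which is small because `e^{-t/τ} t ≤ τ`.
-/

/-! ### The weak derivative on the Fourier side -/

noncomputable section FourierSide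

open scoped SchwartzMap

/-- The defining identity of a weak derivative, for complex valued test functions. -/
theorem HasWeakDeriv.integral_deriv_mul_of_hasCompactSupport {f g : L2 ℂ} (h : HasWeakDeriv f g)
    {φ : ℝ → ℂ} (hφ : ContDiff ℝ ∞ φ) (hc : HasCompactSupport φ) :
    ∫ x, deriv φ x * f x = - ∫ x, φ x * g x := by
  have hre : ContDiff ℝ ∞ (fun x => (φ x).re) := Complex.reCLM.contDiff.comp hφ
  have him : ContDiff ℝ ∞ (fun x => (φ x).im) := Complex.imCLM.contDiff.comp hφ
  have cre : HasCompactSupport (fun x => (φ x).re) := hc.comp_left (g := Complex.re) rfl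
  have cim : HasCompactSupport (fun x => (φ x).im) := hc.comp_left (g := Complex.im) rfl
  have hd : ∀ x, HasDerivAt φ (deriv φ x) x := fun x =>
    (hφ.differentiable (by simp) x).hasDerivAt
  have dre : ∀ x, deriv (fun x => (φ x).re) x = (deriv φ x).re := fun x =>
    (Complex.reCLM.hasFDerivAt.comp_hasDerivAt x (hd x)).deriv
  have dim : ∀ x, deriv (fun x => (φ x).im) x = (deriv φ x).im := fun x =>
    (Complex.imCLM.hasFDerivAt.comp_hasDerivAt x (hd x)).deriv
  have key : ∀ (a b : ℝ → ℝ) (k : L2 ℂ), Integrable (fun x => a x • k x) →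
      Integrable (fun x => b x • k x) →
      ∫ x, ((a x : ℂ) + b x * Complex.I) * k x
        = (∫ x, a x • k x) + Complex.I * ∫ x, b x • k x := by
    intro a b k ha hb
    rw [← integral_const_mul, ← integral_add ha (hb.const_mul _)]
    refine integral_congr_ae (Eventually.of_forall fun x => ?_)
    simp only [Complex.real_smul]
    ring
  have i1 := integrable_testFunction_smul (hre.continuous_deriv (by simp)) cre.deriv f
  have i2 := integrable_testFunction_smul (him.continuous_deriv (by simp)) cim.deriv f
  have i3 := integrable_testFunction_smul hre.continuous cre g
  have i4 := integrable_testFunction_smul him.continuous cim g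
  have e1 := key _ _ f i1 i2
  have e2 := key _ _ g i3 i4
  rw [h _ hre cre, h _ him cim] at e1
  simp only [dre, dim, Complex.re_add_im] at e1 e2
  rw [e1, e2]
  ring

/-- The defining identity of a weak derivative extends from compactly supported test functions
to Schwartz functions, by means of the cut-offs `χ (x / n)`. -/
theorem HasWeakDeriv.integral_deriv_mul_schwartz {f g : L2 ℂ} (h : HasWeakDeriv f g)
    (φ : 𝓢(ℝ, ℂ)) : ∫ x, deriv φ x * f x = - ∫ x, φ x * g x := by
  let χ : ContDiffBump (0 : ℝ) := ⟨1, 2, by norm_num, by norm_num⟩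
  have hχ : ContDiff ℝ ∞ χ := χ.contDiff
  have hχd : ∀ x, HasDerivAt χ (deriv χ x) x := fun x =>
    (hχ.differentiable (by simp) x).hasDerivAt
  obtain ⟨C, hC⟩ : ∃ C, ∀ x, ‖deriv χ x‖ ≤ C :=
    (hχ.continuous_deriv (by simp)).bounded_above_of_compact_support χ.hasCompactSupport.deriv
  have hC0 : 0 ≤ C := (norm_nonneg _).trans (hC 0)
  let r : ℕ → ℝ := fun n => ((n : ℝ) + 1)⁻¹
  have hr0 : ∀ n, 0 < r n := fun n => by positivity
  have hr1 : ∀ n, r n ≤ 1 := fun n => inv_le_one_of_one_le₀ (by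
    have : (0 : ℝ) ≤ n := n.cast_nonneg
    linarith)
  have hrt : Tendsto r atTop (𝓝 0) := by
    simpa [r, one_div] using tendsto_one_div_add_atTop_nhds_zero_nat (𝕜 := ℝ)
  let Φ : ℕ → ℝ → ℂ := fun n x => (χ (r n * x) : ℂ) * φ x
  have hφd : ∀ x, HasDerivAt φ (deriv φ x) x := fun x => (φ.differentiableAt).hasDerivAt
  have hΦd : ∀ n x, HasDerivAt (Φ n)
      (((deriv χ (r n * x) * r n : ℝ) : ℂ) * φ x + (χ (r n * x) : ℂ) * deriv φ x) x := by
    intro n x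
    have h1 : HasDerivAt (fun x => χ (r n * x)) (deriv χ (r n * x) * r n) x := by
      have := HasDerivAt.scomp x (hχd (r n * x)) ((hasDerivAt_id x).const_mul (r n))
      simpa [Function.comp_def, mul_comm] using this
    exact h1.ofReal_comp.mul (hφd x)
  have hΦs : ∀ n, ContDiff ℝ ∞ (Φ n) := fun n =>
    (Complex.ofRealCLM.contDiff.comp (hχ.comp (contDiff_const.mul contDiff_id))).mul (φ.smooth ⊤)
  have hΦc : ∀ n, HasCompactSupport (Φ n) := by
    intro n
    have : HasCompactSupport (fun x => χ (r n * x)) :=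
      χ.hasCompactSupport.comp_homeomorph (Homeomorph.mulLeft₀ (r n) (hr0 n).ne')
    exact (this.comp_left (g := fun y : ℝ => (y : ℂ)) rfl).mul_right
  have hχlim : ∀ x : ℝ, Tendsto (fun n => χ (r n * x)) atTop (𝓝 1) := by
    intro x
    have h1 : Tendsto (fun n => r n * x) atTop (𝓝 0) := by simpa using hrt.mul_const x
    have h2 := (hχ.continuous.tendsto 0).comp h1
    rwa [χ.one_of_mem_closedBall (by simp [χ])] at h2
  have hφ2 : MemLp φ 2 (volume : Measure ℝ) := φ.memLp 2
  have hφ2' : MemLp (deriv φ) 2 (volume : Measure ℝ) :=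
    (SchwartzMap.derivCLM ℝ ℂ φ).memLp 2 volume
  have int : ∀ {a : ℝ → ℂ}, MemLp a 2 (volume : Measure ℝ) → ∀ k : L2 ℂ,
      Integrable (fun x => a x * k x) := fun ha k => ha.integrable_mul (Lp.memLp k)
  have l1 : Tendsto (fun n => ∫ x, deriv (Φ n) x * f x) atTop (𝓝 (∫ x, deriv φ x * f x)) := by
    refine tendsto_integral_of_dominated_convergence
      (fun x => ‖deriv φ x * f x‖ + C * ‖φ x * f x‖) ?_ ?_ ?_ ?_
    · intro n
      exact ((hΦs n).continuous_deriv (by simp)).aestronglyMeasurable.mul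
        (Lp.aestronglyMeasurable f)
    · exact (int hφ2' f).norm.add ((int hφ2 f).norm.const_mul C)
    · intro n
      refine Eventually.of_forall fun x => ?_
      rw [(hΦd n x).deriv]
      simp only [norm_mul]
      have a1 : ‖((deriv χ (r n * x) * r n : ℝ) : ℂ)‖ ≤ C := by
        rw [Complex.norm_real, norm_mul, Real.norm_of_nonneg (hr0 n).le]
        calc _ ≤ C * 1 := mul_le_mul (hC _) (hr1 n) (hr0 n).le hC0
          _ = C := mul_one C
      have a2 : ‖(χ (r n * x) : ℂ)‖ ≤ 1 := by
        rw [Complex.norm_real, Real.norm_of_nonneg χ.nonneg]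
        exact χ.le_one
      calc _ ≤ (C * ‖φ x‖ + 1 * ‖deriv φ x‖) * ‖f x‖ := by
            refine mul_le_mul_of_nonneg_right ((norm_add_le _ _).trans ?_) (norm_nonneg _)
            rw [norm_mul, norm_mul]
            gcongr
        _ = _ := by ring
    · refine Eventually.of_forall fun x => ?_
      simp_rw [(hΦd _ x).deriv]
      have b1 : Tendsto (fun n => ((deriv χ (r n * x) * r n : ℝ) : ℂ)) atTop (𝓝 0) := by
        have : Tendsto (fun n => deriv χ (r n * x) * r n) atTop (𝓝 0) := by
          refine squeeze_zero_norm (a := fun n => C * r n) (fun n => ?_) (by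
            simpa using hrt.const_mul C)
          rw [norm_mul, Real.norm_of_nonneg (hr0 n).le]
          exact mul_le_mul_of_nonneg_right (hC _) (hr0 n).le
        simpa [Function.comp_def] using (Complex.continuous_ofReal.tendsto 0).comp this
      have b2 : Tendsto (fun n => (χ (r n * x) : ℂ)) atTop (𝓝 1) := by
        simpa [Function.comp_def] using (Complex.continuous_ofReal.tendsto 1).comp (hχlim x)
      simpa using ((b1.mul_const (φ x)).add (b2.mul_const (deriv φ x))).mul_const (f x)
  have l2 : Tendsto (fun n => ∫ x, Φ n x * g x) atTop (𝓝 (∫ x, φ x * g x)) := by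
    refine tendsto_integral_of_dominated_convergence (fun x => ‖φ x * g x‖) ?_ ?_ ?_ ?_
    · intro n
      exact (hΦs n).continuous.aestronglyMeasurable.mul (Lp.aestronglyMeasurable g)
    · exact (int hφ2 g).norm
    · intro n
      refine Eventually.of_forall fun x => ?_
      have a2 : ‖(χ (r n * x) : ℂ)‖ ≤ 1 := by
        rw [Complex.norm_real, Real.norm_of_nonneg χ.nonneg]
        exact χ.le_one
      simp only [Φ, norm_mul]
      calc _ ≤ 1 * ‖φ x‖ * ‖g x‖ := by gcongr
        _ = _ := by ring
    · refine Eventually.of_forall fun x => ?_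
      have b2 : Tendsto (fun n => (χ (r n * x) : ℂ)) atTop (𝓝 1) := by
        simpa [Function.comp_def] using (Complex.continuous_ofReal.tendsto 1).comp (hχlim x)
      simpa using (b2.mul_const (φ x)).mul_const (g x)
  refine tendsto_nhds_unique l1 (l2.neg.congr fun n => ?_)
  exact (h.integral_deriv_mul_of_hasCompactSupport (hΦs n) (hΦc n)).symm

theorem lineDeriv_one_eq_deriv (φ : ℝ → ℂ) (x : ℝ) : lineDeriv ℝ φ x 1 = deriv φ x := by
  have := deriv_comp_const_add φ x 0
  simpa [lineDeriv] using this

/-- A weak derivative is a derivative in the sense of tempered distributions, for which Mathlib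
knows the Fourier transform. -/
theorem HasWeakDeriv.lineDerivOp_toTemperedDistribution {f g : L2 ℂ} (h : HasWeakDeriv f g) :
    LineDeriv.lineDerivOp (1 : ℝ) (f : 𝓢'(ℝ, ℂ)) = (g : 𝓢'(ℝ, ℂ)) := by
  ext φ
  rw [TemperedDistribution.lineDerivOp_apply_apply, Lp.toTemperedDistribution_apply,
    Lp.toTemperedDistribution_apply]
  have := h.integral_deriv_mul_schwartz φ
  simp only [smul_eq_mul]
  rw [← neg_eq_iff_eq_neg] at this
  rw [← this, ← integral_neg]
  congr 1
  ext x
  simp [SchwartzMap.lineDerivOp_apply, lineDeriv_one_eq_deriv]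

theorem hasTemperateGrowth_ofReal_inner_one :
    Function.HasTemperateGrowth (fun x : ℝ => ((inner ℝ x (1 : ℝ) : ℝ) : ℂ)) := by
  fun_prop

theorem fourier_lineDerivOp_toTemperedDistribution_apply (f : L2 ℂ) (φ : 𝓢(ℝ, ℂ)) :
    (𝓕 (LineDeriv.lineDerivOp (1 : ℝ) (f : 𝓢'(ℝ, ℂ)))) φ
      = ∫ ξ, φ ξ * (2 * Real.pi * Complex.I * ξ * 𝓕 f ξ) := by
  rw [TemperedDistribution.fourier_lineDerivOp_eq, Lp.fourier_toTemperedDistribution_eq]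
  simp only [smul_apply, TemperedDistribution.smulLeftCLM_apply_apply,
    Lp.toTemperedDistribution_apply, smul_eq_mul]
  rw [← integral_const_mul]
  refine integral_congr_ae (Eventually.of_forall fun ξ => ?_)
  simp only [SchwartzMap.smulLeftCLM_apply_apply hasTemperateGrowth_ofReal_inner_one, smul_eq_mul]
  simp
  ring

/-- On the Fourier side the weak derivative is multiplication by `2πiξ`. -/
theorem hasWeakDeriv_iff_fourier {f g : L2 ℂ} :
    HasWeakDeriv f g ↔ ∀ᵐ ξ : ℝ, 𝓕 g ξ = 2 * Real.pi * Complex.I * ξ * 𝓕 f ξ := by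
  have hloc : ∀ k : L2 ℂ, LocallyIntegrable (k : ℝ → ℂ) :=
    fun k => (Lp.memLp k).locallyIntegrable (by norm_num)
  constructor
  · intro h
    have h1 : ∀ φ : 𝓢(ℝ, ℂ), ∫ ξ, φ ξ * 𝓕 g ξ
        = ∫ ξ, φ ξ * (2 * Real.pi * Complex.I * ξ * 𝓕 f ξ) := by
      intro φ
      rw [← fourier_lineDerivOp_toTemperedDistribution_apply,
        h.lineDerivOp_toTemperedDistribution, Lp.fourier_toTemperedDistribution_eq,
        Lp.toTemperedDistribution_apply]
      rfl
    have hl : LocallyIntegrable (fun ξ : ℝ => 2 * Real.pi * Complex.I * ξ * 𝓕 f ξ) := by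
      have hc : Continuous (fun ξ : ℝ => 2 * Real.pi * Complex.I * (ξ : ℂ)) := by fun_prop
      exact (hloc (𝓕 f)).continuous_smul hc
    refine ae_eq_of_integral_contDiff_smul_eq (hloc (𝓕 g)) hl ?_
    intro φ hφ hc
    have hg₁ : HasCompactSupport (Complex.ofRealCLM ∘ φ) := hc.comp_left rfl
    have hg₂ : ContDiff ℝ ∞ (Complex.ofRealCLM ∘ φ) := by fun_prop
    simpa using h1 (hg₁.toSchwartzMap hg₂)
  · intro h
    have h1 : LineDeriv.lineDerivOp (1 : ℝ) (f : 𝓢'(ℝ, ℂ)) = (g : 𝓢'(ℝ, ℂ)) := by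
      have : 𝓕 (LineDeriv.lineDerivOp (1 : ℝ) (f : 𝓢'(ℝ, ℂ))) = 𝓕 (g : 𝓢'(ℝ, ℂ)) := by
        ext φ
        rw [fourier_lineDerivOp_toTemperedDistribution_apply,
          Lp.fourier_toTemperedDistribution_eq, Lp.toTemperedDistribution_apply]
        refine integral_congr_ae ?_
        filter_upwards [h] with ξ hξ
        rw [hξ, smul_eq_mul]
      simpa only [FourierPair.fourierInv_fourier_eq] using congrArg (fun T => 𝓕⁻ T) this
    intro φ hφ hc
    have hg₁ : HasCompactSupport (Complex.ofRealCLM ∘ φ) := hc.comp_left rfl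
    have hg₂ : ContDiff ℝ ∞ (Complex.ofRealCLM ∘ φ) := by fun_prop
    have h2 := DFunLike.congr_fun h1 (hg₁.toSchwartzMap hg₂)
    rw [TemperedDistribution.lineDerivOp_apply_apply, Lp.toTemperedDistribution_apply,
      Lp.toTemperedDistribution_apply] at h2
    have h3 : ∀ x, deriv (fun x => (φ x : ℂ)) x = ((deriv φ x : ℝ) : ℂ) := fun x =>
      ((hφ.differentiable (by simp) x).hasDerivAt.ofReal_comp).deriv
    rw [← neg_eq_iff_eq_neg, ← integral_neg]
    refine Eq.trans (integral_congr_ae (Eventually.of_forall fun x => ?_)) (h2.trans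
      (integral_congr_ae (Eventually.of_forall fun x => ?_)))
    · have : deriv (hg₁.toSchwartzMap hg₂) x = ((deriv φ x : ℝ) : ℂ) := h3 x
      simp [SchwartzMap.lineDerivOp_apply, lineDeriv_one_eq_deriv, this]
    · simp

end FourierSide

/-! ### The free Schrödinger group and its generator in weak form -/

noncomputable section FreeGroup

open scoped InnerProductSpace

/-- Integration by parts in `H¹`, by Plancherel. -/
theorem HasWeakDeriv.inner_eq_neg {f f' g g' : L2 ℂ} (hf : HasWeakDeriv f f')
    (hg : HasWeakDeriv g g') : ⟪f', g⟫_ℂ = - ⟪f, g'⟫_ℂ := by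
  rw [← Lp.inner_fourier_eq, ← Lp.inner_fourier_eq f, L2.inner_def, L2.inner_def,
    ← integral_neg]
  refine integral_congr_ae ?_
  filter_upwards [hasWeakDeriv_iff_fourier.1 hf, hasWeakDeriv_iff_fourier.1 hg] with ξ h1 h2
  simp only [h1, h2, RCLike.inner_apply, map_mul, Complex.conj_I, Complex.conj_ofReal, map_ofNat]
  ring

/-- The weak derivative is unique. -/
theorem HasWeakDeriv.unique {f g g' : L2 ℂ} (h : HasWeakDeriv f g) (h' : HasWeakDeriv f g') :
    g = g' := by
  apply (Lp.fourierTransformₗᵢ ℝ ℂ).injective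
  refine Lp.ext ?_
  filter_upwards [hasWeakDeriv_iff_fourier.1 h, hasWeakDeriv_iff_fourier.1 h'] with ξ h1 h2
  exact h1.trans h2.symm

/-- The symbol of the free Schrödinger group. -/
def schrodingerSymbol (t ξ : ℝ) : ℂ :=
  Complex.exp ((-(2 * Real.pi ^ 2 * t * ξ ^ 2) : ℝ) * Complex.I)

theorem norm_schrodingerSymbol (t ξ : ℝ) : ‖schrodingerSymbol t ξ‖ = 1 :=
  Complex.norm_exp_ofReal_mul_I _

theorem schrodingerSymbol_zero (ξ : ℝ) : schrodingerSymbol 0 ξ = 1 := by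
  simp [schrodingerSymbol]

theorem schrodingerSymbol_add (s t ξ : ℝ) :
    schrodingerSymbol (s + t) ξ = schrodingerSymbol s ξ * schrodingerSymbol t ξ := by
  rw [schrodingerSymbol, schrodingerSymbol, schrodingerSymbol, ← Complex.exp_add]
  congr 1
  push_cast
  ring

theorem continuous_schrodingerSymbol (ξ : ℝ) : Continuous fun t => schrodingerSymbol t ξ := by
  unfold schrodingerSymbol
  fun_prop

theorem fourier_schrodingerGroup (t : ℝ) (f : L2 ℂ) :
    ∀ᵐ ξ, 𝓕 (schrodingerGroup t f) ξ = schrodingerSymbol t ξ * 𝓕 f ξ := by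
  rw [schrodingerGroup, FourierInvPair.fourier_fourierInv_eq]
  exact (memLp_schrodingerSymbol_mul t (𝓕 f)).coeFn_toLp

theorem L2_ext_fourier {f g : L2 ℂ} (h : ∀ᵐ ξ, 𝓕 f ξ = 𝓕 g ξ) : f = g :=
  (Lp.fourierTransformₗᵢ ℝ ℂ).injective (Lp.ext h)

theorem fourier_add_ae (f g : L2 ℂ) : ∀ᵐ ξ, 𝓕 (f + g) ξ = 𝓕 f ξ + 𝓕 g ξ := by
  rw [FourierTransform.fourier_add]
  exact Lp.coeFn_add _ _

theorem fourier_sub_ae (f g : L2 ℂ) : ∀ᵐ ξ, 𝓕 (f - g) ξ = 𝓕 f ξ - 𝓕 g ξ := by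
  rw [show 𝓕 (f - g) = 𝓕 f - 𝓕 g from (Lp.fourierTransformₗᵢ ℝ ℂ).map_sub f g]
  exact Lp.coeFn_sub _ _

theorem fourier_smul_ae (c : ℂ) (f : L2 ℂ) : ∀ᵐ ξ, 𝓕 (c • f) ξ = c * 𝓕 f ξ := by
  rw [FourierTransform.fourier_smul]
  exact Lp.coeFn_smul _ _

theorem norm_schrodingerGroup (t : ℝ) (f : L2 ℂ) : ‖schrodingerGroup t f‖ = ‖f‖ := by
  rw [← Lp.norm_fourier_eq, ← Lp.norm_fourier_eq f, Lp.norm_def, Lp.norm_def]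
  congr 1
  refine eLpNorm_congr_norm_ae ?_
  filter_upwards [fourier_schrodingerGroup t f] with ξ h
  rw [h, norm_mul, norm_schrodingerSymbol, one_mul]

theorem schrodingerGroup_zero (f : L2 ℂ) : schrodingerGroup 0 f = f := by
  refine L2_ext_fourier ?_
  filter_upwards [fourier_schrodingerGroup 0 f] with ξ h
  rw [h, schrodingerSymbol_zero, one_mul]

theorem schrodingerGroup_add (s t : ℝ) (f : L2 ℂ) :
    schrodingerGroup (s + t) f = schrodingerGroup s (schrodingerGroup t f) := by
  refine L2_ext_fourier ?_
  filter_upwards [fourier_schrodingerGroup (s + t) f, fourier_schrodingerGroup t f,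
    fourier_schrodingerGroup s (schrodingerGroup t f)] with ξ h1 h2 h3
  rw [h1, h3, h2, schrodingerSymbol_add, mul_assoc]

/-- `S(t)` as a linear isometry of `L²`. -/
def schrodingerIsometry (t : ℝ) : L2 ℂ →ₗᵢ[ℂ] L2 ℂ where
  toFun := schrodingerGroup t
  map_add' f g := by
    refine L2_ext_fourier ?_
    filter_upwards [fourier_schrodingerGroup t (f + g), fourier_schrodingerGroup t f,
      fourier_schrodingerGroup t g, fourier_add_ae f g,
      fourier_add_ae (schrodingerGroup t f) (schrodingerGroup t g)] with ξ h1 h2 h3 h4 h5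
    rw [h1, h4, h5, h2, h3, mul_add]
  map_smul' c f := by
    refine L2_ext_fourier ?_
    filter_upwards [fourier_schrodingerGroup t (c • f), fourier_schrodingerGroup t f,
      fourier_smul_ae c f, fourier_smul_ae c (schrodingerGroup t f)] with ξ h1 h2 h3 h4
    rw [h1, h3, RingHom.id_apply, h4, h2]
    ring
  norm_map' := norm_schrodingerGroup t

theorem schrodingerGroup_sub_right (t : ℝ) (f g : L2 ℂ) :
    schrodingerGroup t (f - g) = schrodingerGroup t f - schrodingerGroup t g :=
  (schrodingerIsometry t).map_sub f g

theorem schrodingerGroup_smul (t : ℝ) (c : ℂ) (f : L2 ℂ) :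
    schrodingerGroup t (c • f) = c • schrodingerGroup t f :=
  (schrodingerIsometry t).map_smul c f

theorem inner_schrodingerGroup (t : ℝ) (f g : L2 ℂ) :
    ⟪schrodingerGroup t f, schrodingerGroup t g⟫_ℂ = ⟪f, g⟫_ℂ :=
  (schrodingerIsometry t).inner_map_map f g

/-- `S(t)` commutes with the weak derivative. -/
theorem HasWeakDeriv.schrodingerGroup {f g : L2 ℂ} (h : HasWeakDeriv f g) (t : ℝ) :
    HasWeakDeriv (schrodingerGroup t f) (schrodingerGroup t g) := by
  rw [hasWeakDeriv_iff_fourier]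
  filter_upwards [fourier_schrodingerGroup t f, fourier_schrodingerGroup t g,
    hasWeakDeriv_iff_fourier.1 h] with ξ h1 h2 h3
  rw [h1, h2, h3]
  ring

theorem norm_sq_L2_eq_integral {𝕜 : Type} [RCLike 𝕜] (f : L2 𝕜) : ‖f‖ ^ 2 = ∫ x, ‖f x‖ ^ 2 := by
  have h := L2.inner_def (𝕜 := 𝕜) f f
  rw [inner_self_eq_norm_sq_to_K] at h
  have h2 : ∀ x, inner 𝕜 (f x) (f x) = ((‖f x‖ ^ 2 : ℝ) : 𝕜) := fun x => by
    rw [inner_self_eq_norm_sq_to_K]; push_cast; rfl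
  simp_rw [h2] at h
  rw [integral_ofReal] at h
  exact_mod_cast h

/-- Strong continuity of the group. -/
theorem continuous_schrodingerGroup_left (f : L2 ℂ) : Continuous fun t => schrodingerGroup t f := by
  rw [continuous_iff_continuousAt]
  intro t
  rw [ContinuousAt, tendsto_iff_norm_sub_tendsto_zero]
  have h : ∀ s, ‖schrodingerGroup s f - schrodingerGroup t f‖ ^ 2
      = ∫ ξ, ‖(schrodingerSymbol s ξ - schrodingerSymbol t ξ) * 𝓕 f ξ‖ ^ 2 := by
    intro s
    rw [← Lp.norm_fourier_eq, norm_sq_L2_eq_integral]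
    refine integral_congr_ae ?_
    filter_upwards [fourier_schrodingerGroup s f, fourier_schrodingerGroup t f,
      fourier_sub_ae (schrodingerGroup s f) (schrodingerGroup t f)] with ξ h1 h2 h3
    rw [h3, h1, h2, sub_mul]
  have h0 : Tendsto (fun s => ‖schrodingerGroup s f - schrodingerGroup t f‖ ^ 2) (𝓝 t) (𝓝 0) := by
    simp_rw [h]
    rw [show (0 : ℝ) = ∫ ξ : ℝ, (0 : ℝ) by simp]
    have hm : ∀ s, AEStronglyMeasurable (fun ξ => schrodingerSymbol s ξ) (volume : Measure ℝ) :=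
      fun s => Continuous.aestronglyMeasurable (by unfold schrodingerSymbol; fun_prop)
    refine tendsto_integral_filter_of_dominated_convergence
      (fun ξ => 4 * ‖𝓕 f ξ‖ ^ 2) (Eventually.of_forall fun s => ?_)
      (Eventually.of_forall fun s => Eventually.of_forall fun ξ => ?_) ?_
      (Eventually.of_forall fun ξ => ?_)
    · exact ((((hm s).sub (hm t)).mul (Lp.aestronglyMeasurable _)).norm.pow 2)
    · rw [Real.norm_of_nonneg (by positivity), norm_mul, mul_pow]
      have : ‖schrodingerSymbol s ξ - schrodingerSymbol t ξ‖ ≤ 2 := by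
        refine (norm_sub_le _ _).trans ?_
        rw [norm_schrodingerSymbol, norm_schrodingerSymbol]; norm_num
      have h2 : ‖schrodingerSymbol s ξ - schrodingerSymbol t ξ‖ ^ 2 ≤ 2 ^ 2 := by gcongr
      nlinarith [sq_nonneg ‖𝓕 f ξ‖]
    · exact ((Lp.memLp (𝓕 f)).integrable_norm_pow (by norm_num)).const_mul 4
    · have : Tendsto (fun s => schrodingerSymbol s ξ - schrodingerSymbol t ξ) (𝓝 t) (𝓝 0) := by
        simpa using ((continuous_schrodingerSymbol ξ).tendsto t).sub_const (schrodingerSymbol t ξ)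
      simpa using ((this.mul_const (𝓕 f ξ)).norm.pow 2)
  have := h0.sqrt
  simpa using this

theorem continuousOn_schrodingerGroup {a : ℝ → ℝ} {f : ℝ → L2 ℂ} {s : Set ℝ}
    (ha : ContinuousOn a s) (hf : ContinuousOn f s) :
    ContinuousOn (fun r => schrodingerGroup (a r) (f r)) s := by
  intro r hr
  have h1 : Tendsto (fun x => schrodingerGroup (a x) (f r)) (𝓝[s] r)
      (𝓝 (schrodingerGroup (a r) (f r))) :=
    ((continuous_schrodingerGroup_left (f r)).tendsto (a r)).comp (ha r hr)
  have h2 : Tendsto (fun x => schrodingerGroup (a x) (f x) -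
      schrodingerGroup (a x) (f r)) (𝓝[s] r) (𝓝 0) := by
    rw [tendsto_zero_iff_norm_tendsto_zero]
    simp_rw [← schrodingerGroup_sub_right, norm_schrodingerGroup]
    exact tendsto_iff_norm_sub_tendsto_zero.1 (hf r hr)
  simpa [ContinuousWithinAt] using h2.add h1

theorem continuous_schrodingerGroup {a : ℝ → ℝ} {f : ℝ → L2 ℂ}
    (ha : Continuous a) (hf : Continuous f) :
    Continuous (fun r => schrodingerGroup (a r) (f r)) := by
  rw [← continuousOn_univ] at *
  exact continuousOn_schrodingerGroup ha hf

theorem norm_exp_mul_I_sub_one_le (x : ℝ) : ‖Complex.exp (x * Complex.I) - 1‖ ≤ |x| := by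
  rw [mul_comm]
  exact Real.norm_exp_I_mul_ofReal_sub_one_le

theorem integral_norm_mul_norm_le (f g : L2 ℂ) : ∫ x, ‖f x‖ * ‖g x‖ ≤ ‖f‖ * ‖g‖ := by
  have h := real_inner_le_norm (Lp.memLp f).norm.toLp (Lp.memLp g).norm.toLp
  have e : ∀ k : L2 ℂ, ‖(Lp.memLp k).norm.toLp‖ = ‖k‖ := fun k => by
    rw [Lp.norm_toLp, eLpNorm_norm, Lp.norm_def]
  rw [e, e, L2.inner_def] at h
  refine le_trans (le_of_eq (integral_congr_ae ?_)) h
  filter_upwards [(Lp.memLp f).norm.coeFn_toLp, (Lp.memLp g).norm.coeFn_toLp] with x h1 h2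
  rw [h1, h2]
  simp [mul_comm]

theorem inner_schrodingerGroup_sub_eq_integral (f g : L2 ℂ) (h : ℝ) :
    (h : ℂ)⁻¹ * ⟪g, schrodingerGroup h f - f⟫_ℂ
      = ∫ ξ, (h : ℂ)⁻¹ * (schrodingerSymbol h ξ - 1) * (𝓕 f ξ * starRingEnd ℂ (𝓕 g ξ)) := by
  rw [← Lp.inner_fourier_eq, L2.inner_def, ← integral_const_mul]
  refine integral_congr_ae ?_
  filter_upwards [fourier_schrodingerGroup h f, fourier_sub_ae (schrodingerGroup h f) f]
    with ξ h1 h2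
  rw [RCLike.inner_apply, h2, h1]
  ring

/-- The difference quotient of the symbol is at most `2π²ξ²`, and one factor `ξ` goes to each of
the two functions: no second derivatives are needed. -/
theorem norm_symbol_quotient_mul_le {f f' g g' : L2 ℂ} (hf : HasWeakDeriv f f')
    (hg : HasWeakDeriv g g') {h : ℝ} (hh : 0 < h) :
    ∀ᵐ ξ, ‖(h : ℂ)⁻¹ * (schrodingerSymbol h ξ - 1) * (𝓕 f ξ * starRingEnd ℂ (𝓕 g ξ))‖
      ≤ ‖𝓕 f' ξ‖ * ‖𝓕 g' ξ‖ := by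
  filter_upwards [hasWeakDeriv_iff_fourier.1 hf, hasWeakDeriv_iff_fourier.1 hg] with ξ h1 h2
  have h3 := norm_exp_mul_I_sub_one_le (-(2 * Real.pi ^ 2 * h * ξ ^ 2))
  rw [abs_neg, abs_of_nonneg (by positivity)] at h3
  have h4 : ‖(h : ℂ)⁻¹ * (schrodingerSymbol h ξ - 1)‖ ≤ 2 * Real.pi ^ 2 * ξ ^ 2 := by
    rw [norm_mul, norm_inv, Complex.norm_real, Real.norm_of_nonneg hh.le, inv_mul_le_iff₀ hh]
    refine h3.trans (le_of_eq (by ring))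
  rw [h1, h2, norm_mul]
  simp only [norm_mul, RCLike.norm_conj, Complex.norm_I, Complex.norm_real, Complex.norm_ofNat,
    Real.norm_eq_abs, abs_of_pos Real.pi_pos]
  have h5 : 0 ≤ ‖𝓕 f ξ‖ * ‖𝓕 g ξ‖ := by positivity
  calc _ ≤ 2 * Real.pi ^ 2 * ξ ^ 2 * (‖𝓕 f ξ‖ * ‖𝓕 g ξ‖) := by
        rw [norm_mul] at h4
        exact mul_le_mul_of_nonneg_right h4 h5
    _ ≤ 4 * Real.pi ^ 2 * |ξ| ^ 2 * (‖𝓕 f ξ‖ * ‖𝓕 g ξ‖) := by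
        rw [sq_abs]
        gcongr
        norm_num
    _ = _ := by ring

/-- The generator of the free group in weak form: `h⁻¹ ⟪g, (S(h) - 1) f⟫ → -(i/2) ⟪∂g, ∂f⟫`. -/
theorem tendsto_inner_schrodingerGroup_sub {f f' g g' : L2 ℂ} (hf : HasWeakDeriv f f')
    (hg : HasWeakDeriv g g') :
    Tendsto (fun h : ℝ => (h : ℂ)⁻¹ * ⟪g, schrodingerGroup h f - f⟫_ℂ) (𝓝[>] 0)
      (𝓝 (-(Complex.I / 2) * ⟪g', f'⟫_ℂ)) := by
  have e2 : -(Complex.I / 2) * ⟪g', f'⟫_ℂ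
      = ∫ ξ : ℝ, (-(2 * Real.pi ^ 2 * ξ ^ 2) * Complex.I) * (𝓕 f ξ * starRingEnd ℂ (𝓕 g ξ)) := by
    rw [← Lp.inner_fourier_eq, L2.inner_def, ← integral_const_mul]
    refine integral_congr_ae ?_
    filter_upwards [hasWeakDeriv_iff_fourier.1 hf, hasWeakDeriv_iff_fourier.1 hg] with ξ h1 h2
    rw [RCLike.inner_apply, h1, h2]
    simp only [map_mul, Complex.conj_I, Complex.conj_ofReal, map_ofNat]
    linear_combination (2 * Real.pi ^ 2 * ξ ^ 2 * (𝓕 f ξ * starRingEnd ℂ (𝓕 g ξ))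
      * Complex.I : ℂ) * Complex.I_sq
  simp_rw [inner_schrodingerGroup_sub_eq_integral]
  rw [e2]
  refine tendsto_integral_filter_of_dominated_convergence
    (fun ξ => ‖𝓕 f' ξ‖ * ‖𝓕 g' ξ‖) ?_ ?_ ?_ ?_
  · refine Eventually.of_forall fun h => ?_
    refine ((Continuous.aestronglyMeasurable (by unfold schrodingerSymbol; fun_prop)).mul ?_)
    exact (Lp.aestronglyMeasurable _).mul
      (Complex.continuous_conj.comp_aestronglyMeasurable (Lp.aestronglyMeasurable _))
  · filter_upwards [self_mem_nhdsWithin] with h hh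
    exact norm_symbol_quotient_mul_le hf hg hh
  · exact (Lp.memLp (𝓕 f')).norm.integrable_mul (Lp.memLp (𝓕 g')).norm
  · refine Eventually.of_forall fun ξ => ?_
    refine Tendsto.mul_const _ ?_
    have hd : HasDerivAt (fun h : ℝ => schrodingerSymbol h ξ)
        (-(2 * Real.pi ^ 2 * ξ ^ 2) * Complex.I) 0 := by
      unfold schrodingerSymbol
      have h1 : HasDerivAt (fun h : ℝ => -(2 * Real.pi ^ 2 * h * ξ ^ 2))
          (-(2 * Real.pi ^ 2 * ξ ^ 2)) 0 := by
        have := (((hasDerivAt_id (0 : ℝ)).const_mul (2 * Real.pi ^ 2)).mul_const (ξ ^ 2)).neg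
        simpa only [mul_one, id_eq, Pi.neg_def] using this
      have := (h1.ofReal_comp.mul_const Complex.I).cexp
      simpa using this
    have h2 := hd.tendsto_slope_zero_right
    refine h2.congr fun h => ?_
    rw [zero_add, schrodingerSymbol_zero, Complex.real_smul, Complex.ofReal_inv]

/-- A uniform bound for the difference quotients of `S` in the weak form of its generator. -/
theorem norm_inner_schrodingerGroup_sub_le {f f' g g' : L2 ℂ} (hf : HasWeakDeriv f f')
    (hg : HasWeakDeriv g g') {h : ℝ} (hh : 0 < h) :
    ‖(h : ℂ)⁻¹ * ⟪g, schrodingerGroup h f - f⟫_ℂ‖ ≤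
      ‖f'‖ * ‖g'‖ := by
  rw [inner_schrodingerGroup_sub_eq_integral, ← Lp.norm_fourier_eq f', ← Lp.norm_fourier_eq g']
  refine le_trans ?_ (integral_norm_mul_norm_le _ _)
  exact norm_integral_le_of_norm_le
    ((Lp.memLp (𝓕 f')).norm.integrable_mul (Lp.memLp (𝓕 g')).norm)
    (norm_symbol_quotient_mul_le hf hg hh)

end FreeGroup

/-! ### The Sobolev space `H¹`: embedding in `L^∞` and product rule -/

noncomputable section SobolevSpace

open scoped InnerProductSpace

/-- The Cauchy-Schwarz inequality. -/
theorem integral_mul_sq_le {a b : ℝ → ℝ} (ha : MemLp a 2 volume) (hb : MemLp b 2 volume) :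
    (∫ x, a x * b x) ^ 2 ≤ (∫ x, a x ^ 2) * ∫ x, b x ^ 2 := by
  have h := abs_real_inner_le_norm ha.toLp hb.toLp
  have e : ∀ {k : ℝ → ℝ} (hk : MemLp k 2 volume), ‖hk.toLp‖ ^ 2 = ∫ x, k x ^ 2 := fun {k} hk => by
    rw [norm_sq_L2_eq_integral]
    refine integral_congr_ae ?_
    filter_upwards [hk.coeFn_toLp] with x h1
    rw [h1, Real.norm_eq_abs, sq_abs]
  have e2 : ⟪ha.toLp, hb.toLp⟫_ℝ = ∫ x, a x * b x := by
    rw [L2.inner_def]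
    refine integral_congr_ae ?_
    filter_upwards [ha.coeFn_toLp, hb.coeFn_toLp] with x h1 h2
    rw [h1, h2]
    simp [mul_comm]
  rw [e2] at h
  have h2 := pow_le_pow_left₀ (abs_nonneg _) h 2
  rwa [sq_abs, mul_pow, e, e] at h2

/-- The Fourier transform of an `H¹` function is integrable, with the bound obtained from
Cauchy-Schwarz with the weight `1 + (ξ / A)²`. -/
theorem HasWeakDeriv.integrable_fourier {f f' : L2 ℂ} (h : HasWeakDeriv f f') {A : ℝ}
    (hA : 0 < A) : Integrable (𝓕 f : L2 ℂ) ∧ (∫ ξ, ‖𝓕 f ξ‖) ^ 2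
      ≤ Real.pi * A * ‖f‖ ^ 2 + ‖f'‖ ^ 2 / (4 * Real.pi * A) := by
  let w : ℝ → ℝ := fun ξ => 1 + (ξ / A) ^ 2
  have hw : ∀ ξ, 0 < w ξ := fun ξ => by positivity
  have hwc : Continuous w := by fun_prop
  have hb2 : ∀ᵐ ξ, w ξ * ‖𝓕 f ξ‖ ^ 2
      = ‖𝓕 f ξ‖ ^ 2 + (4 * Real.pi ^ 2 * A ^ 2)⁻¹ * ‖𝓕 f' ξ‖ ^ 2 := by
    filter_upwards [hasWeakDeriv_iff_fourier.1 h] with ξ h1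
    rw [h1]
    simp only [norm_mul, Complex.norm_I, Complex.norm_real, Complex.norm_ofNat,
      Real.norm_eq_abs, abs_of_pos Real.pi_pos, mul_pow, sq_abs, w]
    have := Real.pi_pos
    field_simp
    ring
  have hi : ∀ k : L2 ℂ, Integrable (fun ξ => ‖k ξ‖ ^ 2) := fun k =>
    (Lp.memLp k).integrable_norm_pow (by norm_num)
  have iR := (hi (𝓕 f)).add ((hi (𝓕 f')).const_mul (4 * Real.pi ^ 2 * A ^ 2)⁻¹)
  have iL : Integrable (fun ξ => w ξ * ‖𝓕 f ξ‖ ^ 2) := iR.congr (hb2.mono fun ξ hξ => hξ.symm)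
  have ma : MemLp (fun ξ => √(w ξ)⁻¹) 2 (volume : Measure ℝ) := by
    rw [memLp_two_iff_integrable_sq (Continuous.aestronglyMeasurable (by
      exact (hwc.inv₀ fun ξ => (hw ξ).ne').sqrt))]
    have := integrable_inv_one_add_sq.comp_div hA.ne'
    refine this.congr (Eventually.of_forall fun ξ => ?_)
    simp only [Real.sq_sqrt (inv_pos.2 (hw ξ)).le, w]
  have mb : MemLp (fun ξ => √(w ξ) * ‖𝓕 f ξ‖) 2 (volume : Measure ℝ) := by
    have hm : AEStronglyMeasurable (fun ξ => √(w ξ) * ‖𝓕 f ξ‖) (volume : Measure ℝ) :=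
      hwc.sqrt.aestronglyMeasurable.mul (Lp.aestronglyMeasurable _).norm
    rw [memLp_two_iff_integrable_sq hm]
    refine iL.congr (Eventually.of_forall fun ξ => ?_)
    simp only [mul_pow, Real.sq_sqrt (hw ξ).le]
  have hab : ∀ ξ, √(w ξ)⁻¹ * (√(w ξ) * ‖𝓕 f ξ‖) = ‖𝓕 f ξ‖ := fun ξ => by
    rw [← mul_assoc, ← Real.sqrt_mul (inv_pos.2 (hw ξ)).le, inv_mul_cancel₀ (hw ξ).ne',
      Real.sqrt_one, one_mul]
  constructor
  · rw [← integrable_norm_iff (Lp.aestronglyMeasurable _)]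
    exact (ma.integrable_mul mb).congr (Eventually.of_forall hab)
  · have := integral_mul_sq_le ma mb
    simp only [hab, mul_pow, Real.sq_sqrt (hw _).le, Real.sq_sqrt (inv_pos.2 (hw _)).le] at this
    refine this.trans (le_of_eq ?_)
    rw [integral_congr_ae hb2, integral_add (hi _) ((hi _).const_mul _), integral_const_mul,
      ← norm_sq_L2_eq_integral, ← norm_sq_L2_eq_integral, Lp.norm_fourier_eq, Lp.norm_fourier_eq]
    have := Measure.integral_comp_div (fun y : ℝ => (1 + y ^ 2)⁻¹) A
    simp only [w]
    rw [this, integral_univ_inv_one_add_sq, abs_of_pos hA, smul_eq_mul]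
    have := Real.pi_pos
    field_simp

open scoped SchwartzMap in
/-- Fourier inversion for an `L²` function with integrable `L²` Fourier transform. -/
theorem ae_eq_fourierInv_of_integrable {f : L2 ℂ} (h : Integrable (𝓕 f : L2 ℂ)) :
    ∀ᵐ x, f x = ∫ ξ, Real.fourierChar (ξ * x) • 𝓕 f ξ := by
  let G : ℝ → ℂ := ((𝓕 f : L2 ℂ) : ℝ → ℂ)
  let F : ℝ → ℂ := VectorFourier.fourierIntegral Real.fourierChar volume (-innerₗ ℝ) G
  have hF : ∀ x, F x = ∫ ξ, Real.fourierChar (ξ * x) • 𝓕 f ξ := fun x => by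
    simp [F, G, VectorFourier.fourierIntegral, mul_comm]
  have hFc : Continuous F := VectorFourier.fourierIntegral_continuous Real.continuous_fourierChar
    (by simp only [LinearMap.neg_apply, innerₗ_apply_apply]; fun_prop) h
  simp_rw [← hF]
  refine ae_eq_of_integral_contDiff_smul_eq ((Lp.memLp f).locallyIntegrable (by norm_num))
    hFc.locallyIntegrable ?_
  intro φ hφ hc
  have hg₁ : HasCompactSupport (Complex.ofRealCLM ∘ φ) := hc.comp_left rfl
  have hg₂ : ContDiff ℝ ∞ (Complex.ofRealCLM ∘ φ) := by fun_prop
  let Φ : 𝓢(ℝ, ℂ) := hg₁.toSchwartzMap hg₂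
  have h1 := DFunLike.congr_fun (Lp.fourier_toTemperedDistribution_eq f) (𝓕⁻ Φ)
  rw [TemperedDistribution.fourier_apply, FourierInvPair.fourier_fourierInv_eq,
    Lp.toTemperedDistribution_apply, Lp.toTemperedDistribution_apply] at h1
  have h2 := VectorFourier.integral_fourierIntegral_smul_eq_flip (μ := volume) (ν := volume)
    (L := -innerₗ ℝ) Real.continuous_fourierChar
    (by simp only [LinearMap.neg_apply, innerₗ_apply_apply]; fun_prop) Φ.integrable h
  have h3 : ∀ ξ, VectorFourier.fourierIntegral Real.fourierChar volume (-innerₗ ℝ) Φ ξ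
      = (𝓕⁻ Φ) ξ := fun ξ => by
    rw [SchwartzMap.fourierInv_coe]; rfl
  have h4 : (-innerₗ ℝ : ℝ →ₗ[ℝ] ℝ →ₗ[ℝ] ℝ).flip = -innerₗ ℝ := by
    ext; simp
  rw [h4] at h2
  simp_rw [h3] at h2
  have h5 := h1.trans h2
  simpa [Φ, F, G] using h5

/-- The embedding `H¹ ⊂ L^∞`, with a parameter which makes the coefficient of the derivative as
small as desired. -/
theorem HasWeakDeriv.ae_norm_sq_le {f f' : L2 ℂ} (h : HasWeakDeriv f f') {A : ℝ} (hA : 0 < A) :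
    ∀ᵐ x, ‖f x‖ ^ 2 ≤ Real.pi * A * ‖f‖ ^ 2 + ‖f'‖ ^ 2 / (4 * Real.pi * A) := by
  obtain ⟨h1, h2⟩ := h.integrable_fourier hA
  filter_upwards [ae_eq_fourierInv_of_integrable h1] with x hx
  refine le_trans ?_ h2
  rw [hx]
  gcongr
  refine (norm_integral_le_integral_norm _).trans (le_of_eq ?_)
  simp only [Circle.norm_smul]

theorem H1.hasWeakDeriv {𝕜 : Type} [RCLike 𝕜] (f : H1 𝕜) : HasWeakDeriv f.fn f.dx := f.2

theorem H1.norm_sq {𝕜 : Type} [RCLike 𝕜] (f : H1 𝕜) : ‖f‖ ^ 2 = ‖f.fn‖ ^ 2 + ‖f.dx‖ ^ 2 :=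
  WithLp.prod_norm_sq_eq_of_L2 f.1

theorem H1.norm_fn_le {𝕜 : Type} [RCLike 𝕜] (f : H1 𝕜) : ‖f.fn‖ ≤ ‖f‖ := by
  have := f.norm_sq
  exact (pow_le_pow_iff_left₀ (norm_nonneg _) (norm_nonneg _) two_ne_zero).1
    (by nlinarith [sq_nonneg ‖f.dx‖])

theorem H1.norm_dx_le {𝕜 : Type} [RCLike 𝕜] (f : H1 𝕜) : ‖f.dx‖ ≤ ‖f‖ := by
  have := f.norm_sq
  exact (pow_le_pow_iff_left₀ (norm_nonneg _) (norm_nonneg _) two_ne_zero).1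
    (by nlinarith [sq_nonneg ‖f.fn‖])

theorem H1.fn_sub {𝕜 : Type} [RCLike 𝕜] (f g : H1 𝕜) : (f - g).fn = f.fn - g.fn := rfl

theorem H1.dx_sub {𝕜 : Type} [RCLike 𝕜] (f g : H1 𝕜) : (f - g).dx = f.dx - g.dx := rfl

theorem H1.continuous_fn {𝕜 : Type} [RCLike 𝕜] : Continuous (H1.fn : H1 𝕜 → L2 𝕜) :=
  (LipschitzWith.of_dist_le_mul (K := 1) fun f g => by
    rw [dist_eq_norm, dist_eq_norm, ← H1.fn_sub, NNReal.coe_one, one_mul]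
    exact H1.norm_fn_le _).continuous

theorem H1.continuous_dx {𝕜 : Type} [RCLike 𝕜] : Continuous (H1.dx : H1 𝕜 → L2 𝕜) :=
  (LipschitzWith.of_dist_le_mul (K := 1) fun f g => by
    rw [dist_eq_norm, dist_eq_norm, ← H1.dx_sub, NNReal.coe_one, one_mul]
    exact H1.norm_dx_le _).continuous

theorem HasWeakDeriv.ae_norm_le {f f' : L2 ℂ} (h : HasWeakDeriv f f') :
    ∀ᵐ x, ‖f x‖ ≤ 2 * (‖f‖ + ‖f'‖) := by
  filter_upwards [h.ae_norm_sq_le one_pos] with x hx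
  refine (pow_le_pow_iff_left₀ (norm_nonneg _) (by positivity) two_ne_zero).1 (hx.trans ?_)
  have h1 := Real.pi_le_four
  have h2 : ‖f'‖ ^ 2 / (4 * Real.pi * 1) ≤ ‖f'‖ ^ 2 := by
    refine div_le_self (sq_nonneg _) ?_
    linarith [Real.pi_gt_three]
  nlinarith [norm_nonneg f, norm_nonneg f', mul_nonneg (norm_nonneg f) (norm_nonneg f'),
    sq_nonneg ‖f‖, sq_nonneg ‖f'‖]

theorem H1.ae_norm_le (f : H1 ℂ) : ∀ᵐ x, ‖f.fn x‖ ≤ 4 * ‖f‖ := by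
  filter_upwards [f.hasWeakDeriv.ae_norm_le] with x hx
  linarith [f.norm_fn_le, f.norm_dx_le]

/-- The inclusion of the real space `L²(ℝ; ℝ)` in `L²(ℝ; ℂ)`. -/
def ofRealL2 : L2 ℝ →L[ℝ] L2 ℂ := ContinuousLinearMap.compLpL 2 volume Complex.ofRealCLM

theorem ofRealL2_coeFn (f : L2 ℝ) : ∀ᵐ x, ofRealL2 f x = (f x : ℂ) :=
  ContinuousLinearMap.coeFn_compLpL Complex.ofRealCLM f

theorem norm_ofRealL2 (f : L2 ℝ) : ‖ofRealL2 f‖ = ‖f‖ := by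
  rw [Lp.norm_def, Lp.norm_def]
  congr 1
  refine eLpNorm_congr_norm_ae ?_
  filter_upwards [ofRealL2_coeFn f] with x h
  rw [h, Complex.norm_real]

theorem HasWeakDeriv.ofReal {f f' : L2 ℝ} (h : HasWeakDeriv f f') :
    HasWeakDeriv (ofRealL2 f) (ofRealL2 f') := by
  intro φ hφ hc
  have e : ∀ (ψ : ℝ → ℝ) (k : L2 ℝ), ∫ x, ψ x • ofRealL2 k x = ((∫ x, ψ x • k x : ℝ) : ℂ) := by
    intro ψ k
    rw [← integral_complex_ofReal]
    refine integral_congr_ae ?_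
    filter_upwards [ofRealL2_coeFn k] with x h
    rw [h]
    simp
  rw [e, e, h φ hφ hc, Complex.ofReal_neg]

theorem HasWeakDeriv.star {f f' : L2 ℂ} (h : HasWeakDeriv f f') :
    HasWeakDeriv (star f) (star f') := by
  intro φ hφ hc
  have e : ∀ (ψ : ℝ → ℝ) (k : L2 ℂ), ∫ x, ψ x • (Star.star k : L2 ℂ) x
      = starRingEnd ℂ (∫ x, ψ x • k x) := by
    intro ψ k
    rw [← integral_conj]
    refine integral_congr_ae ?_
    filter_upwards [Lp.coeFn_star k] with x h
    rw [h]
    simp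
  rw [e, e, h φ hφ hc, map_neg]

/-- The product rule with a test function as one of the factors. -/
theorem HasWeakDeriv.testFunction_smul {g g' : L2 ℂ} (h : HasWeakDeriv g g') {φ : ℝ → ℝ}
    (hφ : ContDiff ℝ ∞ φ) (hc : HasCompactSupport φ) {p p' : L2 ℂ}
    (hp : ∀ᵐ x, p x = φ x • g x) (hp' : ∀ᵐ x, p' x = deriv φ x • g x + φ x • g' x) :
    HasWeakDeriv p p' := by
  intro ψ hψ hψc
  have h1 := h (fun x => ψ x * φ x) (hψ.mul hφ) hψc.mul_right
  have hd : ∀ x, deriv (fun x => ψ x * φ x) x = deriv ψ x * φ x + ψ x * deriv φ x := fun x =>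
    ((hψ.differentiable (by simp) x).hasDerivAt.mul
      (hφ.differentiable (by simp) x).hasDerivAt).deriv
  have i1 := integrable_testFunction_smul ((hψ.continuous_deriv (by simp)).mul hφ.continuous)
    (hc.mul_left (f := deriv ψ)) g
  have i2 := integrable_testFunction_smul (hψ.continuous.mul (hφ.continuous_deriv (by simp)))
    (hψc.mul_right (f' := deriv φ)) g
  have i3 := integrable_testFunction_smul (hψ.continuous.mul hφ.continuous)
    (hψc.mul_right (f' := φ)) g'
  simp only [hd, add_smul] at h1
  rw [integral_add (by simpa using i1) (by simpa using i2)] at h1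
  have e1 : ∫ x, deriv ψ x • p x = ∫ x, (deriv ψ x * φ x) • g x := by
    refine integral_congr_ae ?_
    filter_upwards [hp] with x hx
    rw [hx, smul_smul]
  have e2 : ∫ x, ψ x • p' x = (∫ x, (ψ x * deriv φ x) • g x) + ∫ x, (ψ x * φ x) • g' x := by
    rw [← integral_add (by simpa using i2) (by simpa using i3)]
    refine integral_congr_ae ?_
    filter_upwards [hp'] with x hx
    rw [hx, smul_add, smul_smul, smul_smul]
  rw [e1, e2, eq_sub_of_add_eq h1]
  ring

theorem memLp_testFunction_smul {φ : ℝ → ℝ} (hφ : Continuous φ)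
    (hc : HasCompactSupport φ) (f : L2 ℂ) : MemLp (fun x => φ x • f x) 2 volume := by
  obtain ⟨C, hC⟩ := hφ.bounded_above_of_compact_support hc
  refine (Lp.memLp f).of_le_mul (c := C)
    (hφ.aestronglyMeasurable.smul (Lp.aestronglyMeasurable f)) (Eventually.of_forall fun x => ?_)
  rw [norm_smul]
  exact mul_le_mul_of_nonneg_right (hC x) (norm_nonneg _)

/-- Integration by parts in `H¹`, in bilinear form. -/
theorem HasWeakDeriv.integral_mul_eq_neg {f f' g g' : L2 ℂ} (hf : HasWeakDeriv f f')
    (hg : HasWeakDeriv g g') : ∫ x, g x * f' x = - ∫ x, g' x * f x := by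
  have h := hf.star.inner_eq_neg hg
  have e : ∀ a b : L2 ℂ, ⟪Star.star a, b⟫_ℂ = ∫ x, b x * a x := fun a b => by
    rw [L2.inner_def]
    refine integral_congr_ae ?_
    filter_upwards [Lp.coeFn_star a] with x h
    rw [h]
    simp
  rwa [e, e] at h

/-- The product rule for weak derivatives: if `φ` is a test function, `φ g` is an admissible
factor in the integration by parts against `f`. -/
theorem HasWeakDeriv.mul {f f' g g' p p' : L2 ℂ} (hf : HasWeakDeriv f f')
    (hg : HasWeakDeriv g g') (hp : ∀ᵐ x, p x = f x * g x)
    (hp' : ∀ᵐ x, p' x = f' x * g x + f x * g' x) : HasWeakDeriv p p' := by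
  intro φ hφ hc
  have hd := hφ.continuous_deriv (by simp)
  have m1 := memLp_testFunction_smul hφ.continuous hc g
  have m2 := memLp_testFunction_smul hd hc.deriv g
  have m3 := memLp_testFunction_smul hφ.continuous hc g'
  have h1 : HasWeakDeriv m1.toLp (m2.add m3).toLp :=
    hg.testFunction_smul hφ hc m1.coeFn_toLp (m2.add m3).coeFn_toLp
  have h2 := hf.integral_mul_eq_neg h1
  have i1 : Integrable (fun x => (deriv φ x • g x) * f x) := m2.integrable_mul (Lp.memLp f)
  have i2 : Integrable (fun x => (φ x • g' x) * f x) := m3.integrable_mul (Lp.memLp f)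
  have i3 : Integrable (fun x => (φ x • g x) * f' x) := m1.integrable_mul (Lp.memLp f')
  have e1 : ∫ x, m1.toLp _ x * f' x = ∫ x, (φ x • g x) * f' x := by
    refine integral_congr_ae ?_
    filter_upwards [m1.coeFn_toLp] with x hx
    rw [hx]
  have e2 : ∫ x, (m2.add m3).toLp _ x * f x
      = (∫ x, (deriv φ x • g x) * f x) + ∫ x, (φ x • g' x) * f x := by
    rw [← integral_add i1 i2]
    refine integral_congr_ae ?_
    filter_upwards [(m2.add m3).coeFn_toLp] with x hx
    rw [hx, Pi.add_apply, add_mul]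
  have e3 : ∫ x, deriv φ x • p x = ∫ x, (deriv φ x • g x) * f x := by
    refine integral_congr_ae ?_
    filter_upwards [hp] with x hx
    rw [hx, smul_mul_assoc, mul_comm]
  have e4 : ∫ x, φ x • p' x = (∫ x, (φ x • g x) * f' x) + ∫ x, (φ x • g' x) * f x := by
    rw [← integral_add i3 i2]
    refine integral_congr_ae ?_
    filter_upwards [hp'] with x hx
    rw [hx]
    simp only [Complex.real_smul]
    ring
  rw [e1, e2] at h2
  rw [e3, e4, h2]
  ring

theorem HasWeakDeriv.intervalIntegral {F F' : ℝ → L2 ℂ} {a b : ℝ}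
    (h : ∀ s ∈ uIcc a b, HasWeakDeriv (F s) (F' s)) (hF : IntervalIntegrable F volume a b)
    (hF' : IntervalIntegrable F' volume a b) :
    HasWeakDeriv (∫ s in a..b, F s) (∫ s in a..b, F' s) := by
  intro φ hφ hc
  have key : ∀ {ψ : ℝ → ℝ} (_ : Continuous ψ) (_ : HasCompactSupport ψ),
      ∃ ℓ : L2 ℂ →L[ℂ] ℂ, ∀ k : L2 ℂ, ℓ k = ∫ x, ψ x • k x := by
    intro ψ hψ hψc
    have m : MemLp (fun x => (ψ x : ℂ)) 2 (volume : Measure ℝ) :=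
      (hψ.memLp_of_hasCompactSupport hψc).ofReal
    refine ⟨innerSL ℂ m.toLp, fun k => ?_⟩
    rw [innerSL_apply_apply, L2.inner_def]
    refine integral_congr_ae ?_
    filter_upwards [m.coeFn_toLp] with x hx
    rw [hx]
    simp [mul_comm]
  obtain ⟨ℓ, hℓ⟩ := key hφ.continuous hc
  obtain ⟨ℓ', hℓ'⟩ := key (hφ.continuous_deriv (by simp)) hc.deriv
  rw [← hℓ, ← hℓ', ← ContinuousLinearMap.intervalIntegral_comp_comm _ hF,
    ← ContinuousLinearMap.intervalIntegral_comp_comm _ hF', ← intervalIntegral.integral_neg]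
  refine intervalIntegral.integral_congr fun s hs => ?_
  rw [hℓ, hℓ', h s hs φ hφ hc]

end SobolevSpace

/-! ### Products in `L²` with a bounded factor -/

noncomputable section Products

open scoped InnerProductSpace

theorem toL2_coeFn {𝕜 : Type} [RCLike 𝕜] {f : ℝ → 𝕜} (h : MemLp f 2 volume) :
    ∀ᵐ x, toL2 f x = f x := by
  rw [toL2, dif_pos h]
  exact h.coeFn_toLp

theorem toL2_congr {𝕜 : Type} [RCLike 𝕜] {f g : ℝ → 𝕜} (h : ∀ᵐ x, f x = g x) :
    toL2 f = toL2 g := by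
  have e : MemLp f 2 volume ↔ MemLp g 2 volume := memLp_congr_ae h
  by_cases hf : MemLp f 2 volume
  · refine Lp.ext ?_
    filter_upwards [h, toL2_coeFn hf, toL2_coeFn (e.1 hf)] with x h1 h2 h3
    rw [h2, h3, h1]
  · rw [toL2, toL2, dif_neg hf, dif_neg (fun hg => hf (e.2 hg))]

/-- The pointwise product of two `L²` functions. It is meaningful if one of them is bounded. -/
def mulL2 (f g : L2 ℂ) : L2 ℂ := toL2 fun x => f x * g x

theorem memLp_mul_of_bounded {f g : L2 ℂ} {M : ℝ} (hf : ∀ᵐ x, ‖f x‖ ≤ M) :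
    MemLp (fun x => f x * g x) 2 volume := by
  refine (Lp.memLp g).of_le_mul (c := M)
    ((Lp.aestronglyMeasurable f).mul (Lp.aestronglyMeasurable g)) ?_
  filter_upwards [hf] with x hx
  rw [norm_mul]
  gcongr

theorem mulL2_coeFn {f g : L2 ℂ} {M : ℝ} (hf : ∀ᵐ x, ‖f x‖ ≤ M) :
    ∀ᵐ x, mulL2 f g x = f x * g x :=
  toL2_coeFn (memLp_mul_of_bounded hf)

theorem mulL2_comm (f g : L2 ℂ) : mulL2 f g = mulL2 g f := by
  simp only [mulL2, mul_comm]

theorem norm_mulL2_le {f g : L2 ℂ} {M : ℝ} (hf : ∀ᵐ x, ‖f x‖ ≤ M) :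
    ‖mulL2 f g‖ ≤ M * ‖g‖ := by
  refine Lp.norm_le_mul_norm_of_ae_le_mul ?_
  filter_upwards [hf, mulL2_coeFn (g := g) hf] with x h1 h2
  rw [h2, norm_mul]
  gcongr

theorem ae_norm_sub_le {f g : L2 ℂ} {M M' : ℝ} (hf : ∀ᵐ x, ‖f x‖ ≤ M) (hg : ∀ᵐ x, ‖g x‖ ≤ M') :
    ∀ᵐ x, ‖(f - g : L2 ℂ) x‖ ≤ M + M' := by
  filter_upwards [hf, hg, Lp.coeFn_sub f g] with x h1 h2 h3
  rw [h3, Pi.sub_apply]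
  exact (norm_sub_le _ _).trans (add_le_add h1 h2)

theorem mulL2_sub_left {f f' g : L2 ℂ} {M M' : ℝ} (hf : ∀ᵐ x, ‖f x‖ ≤ M)
    (hf' : ∀ᵐ x, ‖f' x‖ ≤ M') : mulL2 (f - f') g = mulL2 f g - mulL2 f' g := by
  refine Lp.ext ?_
  filter_upwards [mulL2_coeFn (g := g) hf, mulL2_coeFn (g := g) hf',
    mulL2_coeFn (g := g) (ae_norm_sub_le hf hf'), Lp.coeFn_sub f f',
    Lp.coeFn_sub (mulL2 f g) (mulL2 f' g)] with x h1 h2 h3 h4 h5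
  rw [h3, h5, Pi.sub_apply, h1, h2, h4, Pi.sub_apply, sub_mul]

theorem mulL2_sub_right {f g g' : L2 ℂ} {M : ℝ} (hf : ∀ᵐ x, ‖f x‖ ≤ M) :
    mulL2 f (g - g') = mulL2 f g - mulL2 f g' := by
  refine Lp.ext ?_
  filter_upwards [mulL2_coeFn (g := g) hf, mulL2_coeFn (g := g') hf,
    mulL2_coeFn (g := g - g') hf, Lp.coeFn_sub g g',
    Lp.coeFn_sub (mulL2 f g) (mulL2 f g')] with x h1 h2 h3 h4 h5
  rw [h3, h5, Pi.sub_apply, h1, h2, h4, Pi.sub_apply, mul_sub]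

theorem continuousOn_mulL2 {f : ℝ → H1 ℂ} {g : ℝ → L2 ℂ} {s : Set ℝ} (hf : ContinuousOn f s)
    (hg : ContinuousOn g s) : ContinuousOn (fun t => mulL2 (f t).fn (g t)) s := by
  intro t ht
  rw [ContinuousWithinAt, tendsto_iff_norm_sub_tendsto_zero]
  have e : ∀ r, mulL2 (f r).fn (g r) - mulL2 (f t).fn (g t)
      = mulL2 (f r - f t).fn (g r) + mulL2 (f t).fn (g r - g t) := by
    intro r
    rw [H1.fn_sub, mulL2_sub_left (f r).ae_norm_le (f t).ae_norm_le,
      mulL2_sub_right (f t).ae_norm_le]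
    abel
  have l1 : Tendsto (fun r => ‖f r - f t‖) (𝓝[s] t) (𝓝 0) :=
    tendsto_iff_norm_sub_tendsto_zero.1 (hf t ht)
  have l2 : Tendsto (fun r => ‖g r - g t‖) (𝓝[s] t) (𝓝 0) :=
    tendsto_iff_norm_sub_tendsto_zero.1 (hg t ht)
  have l3 : Tendsto (fun r => ‖g r‖) (𝓝[s] t) (𝓝 ‖g t‖) := (hg t ht).norm
  refine squeeze_zero (g := fun r => 4 * ‖f r - f t‖ * ‖g r‖ + 4 * ‖f t‖ * ‖g r - g t‖)
    (fun r => norm_nonneg _) (fun r => ?_) ?_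
  · rw [e]
    exact (norm_add_le _ _).trans (add_le_add (norm_mulL2_le (f r - f t).ae_norm_le)
      (norm_mulL2_le (f t).ae_norm_le))
  · simpa using ((l1.const_mul 4).mul l3).add (l2.const_mul (4 * ‖f t‖))

/-- An element of `H¹(ℝ; ℝ)` as an element of `H¹(ℝ; ℂ)`. -/
def H1.ofReal (v : H1 ℝ) : H1 ℂ :=
  ⟨WithLp.toLp 2 (ofRealL2 v.fn, ofRealL2 v.dx), v.hasWeakDeriv.ofReal⟩

theorem H1.ofReal_fn (v : H1 ℝ) : v.ofReal.fn = ofRealL2 v.fn := rfl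

theorem H1.ofReal_dx (v : H1 ℝ) : v.ofReal.dx = ofRealL2 v.dx := rfl

theorem H1.continuous_ofReal : Continuous H1.ofReal := by
  refine (LipschitzWith.of_dist_le_mul (K := 1) fun f g => ?_).continuous
  rw [dist_eq_norm, dist_eq_norm, NNReal.coe_one, one_mul]
  refine (pow_le_pow_iff_left₀ (norm_nonneg _) (norm_nonneg _) two_ne_zero).1 (le_of_eq ?_)
  rw [H1.norm_sq, H1.norm_sq, H1.fn_sub, H1.dx_sub, H1.ofReal_fn, H1.ofReal_dx, H1.ofReal_fn,
    H1.ofReal_dx, ← map_sub, ← map_sub, norm_ofRealL2, norm_ofRealL2]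
  rfl

theorem H1.hasWeakDeriv_mulL2 (f g : H1 ℂ) :
    HasWeakDeriv (mulL2 f.fn g.fn) (mulL2 g.fn f.dx + mulL2 f.fn g.dx) := by
  refine f.hasWeakDeriv.mul g.hasWeakDeriv (mulL2_coeFn f.ae_norm_le) ?_
  filter_upwards [mulL2_coeFn (g := f.dx) g.ae_norm_le, mulL2_coeFn (g := g.dx) f.ae_norm_le,
    Lp.coeFn_add (mulL2 g.fn f.dx) (mulL2 f.fn g.dx)] with x h1 h2 h3
  rw [h3, Pi.add_apply, h1, h2, mul_comm (f.dx x)]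

/-- The density `|f|²`, as an element of `L²`. It is meaningful if `f` is bounded. -/
def sqL2 (f : L2 ℂ) : L2 ℝ := toL2 fun x => ‖f x‖ ^ 2

theorem memLp_norm_sq {f : L2 ℂ} {M : ℝ} (hf : ∀ᵐ x, ‖f x‖ ≤ M) :
    MemLp (fun x => ‖f x‖ ^ 2) 2 volume := by
  refine (Lp.memLp f).of_le_mul (c := M) ((Lp.aestronglyMeasurable f).norm.pow 2) ?_
  filter_upwards [hf] with x hx
  rw [norm_pow, norm_norm, sq]
  gcongr

theorem sqL2_coeFn {f : L2 ℂ} {M : ℝ} (hf : ∀ᵐ x, ‖f x‖ ≤ M) :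
    ∀ᵐ x, sqL2 f x = ‖f x‖ ^ 2 := toL2_coeFn (memLp_norm_sq hf)

theorem norm_sqL2_sub_le {f g : L2 ℂ} {M M' : ℝ} (hf : ∀ᵐ x, ‖f x‖ ≤ M)
    (hg : ∀ᵐ x, ‖g x‖ ≤ M') : ‖sqL2 f - sqL2 g‖ ≤ (M + M') * ‖f - g‖ := by
  refine Lp.norm_le_mul_norm_of_ae_le_mul ?_
  filter_upwards [hf, hg, sqL2_coeFn hf, sqL2_coeFn hg, Lp.coeFn_sub f g,
    Lp.coeFn_sub (sqL2 f) (sqL2 g)] with x h1 h2 h3 h4 h5 h6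
  rw [h6, h5, Pi.sub_apply, Pi.sub_apply, h3, h4, sq_sub_sq, norm_mul, Real.norm_eq_abs,
    Real.norm_eq_abs, abs_of_nonneg (by positivity)]
  exact mul_le_mul (add_le_add h1 h2) (abs_norm_sub_norm_le (f x) (g x)) (abs_nonneg _)
    (add_nonneg ((norm_nonneg _).trans h1) ((norm_nonneg _).trans h2))

theorem norm_sqL2_le {f : L2 ℂ} {M : ℝ} (hf : ∀ᵐ x, ‖f x‖ ≤ M) : ‖sqL2 f‖ ≤ M * ‖f‖ := by
  refine Lp.norm_le_mul_norm_of_ae_le_mul ?_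
  filter_upwards [hf, sqL2_coeFn hf] with x h1 h2
  rw [h2, norm_pow, norm_norm, sq]
  gcongr

theorem continuousOn_sqL2 {f : ℝ → H1 ℂ} {s : Set ℝ} (hf : ContinuousOn f s) :
    ContinuousOn (fun t => sqL2 (f t).fn) s := by
  intro t ht
  rw [ContinuousWithinAt, tendsto_iff_norm_sub_tendsto_zero]
  have l1 : Tendsto (fun r => ‖f r - f t‖) (𝓝[s] t) (𝓝 0) :=
    tendsto_iff_norm_sub_tendsto_zero.1 (hf t ht)
  have l2 : Tendsto (fun r => ‖f r‖) (𝓝[s] t) (𝓝 ‖f t‖) := (hf t ht).norm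
  refine squeeze_zero (g := fun r => (4 * ‖f r‖ + 4 * ‖f t‖) * ‖f r - f t‖)
    (fun r => norm_nonneg _) (fun r => ?_) ?_
  · refine (norm_sqL2_sub_le (f r).ae_norm_le (f t).ae_norm_le).trans ?_
    rw [← H1.fn_sub]
    gcongr
    exact H1.norm_fn_le _
  · simpa using ((l2.const_mul 4).add_const (4 * ‖f t‖)).mul l1

/-- The polarised form of `∫ v |u|²`. -/
theorem inner_sqL2_sub {v : L2 ℝ} {a b : L2 ℂ} {M M' : ℝ} (ha : ∀ᵐ x, ‖a x‖ ≤ M)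
    (hb : ∀ᵐ x, ‖b x‖ ≤ M') : ⟪v, sqL2 a - sqL2 b⟫_ℝ
      = (⟪mulL2 a (ofRealL2 v) + mulL2 b (ofRealL2 v), a - b⟫_ℂ).re := by
  rw [L2.inner_def, L2.inner_def]
  have hi := L2.integrable_inner (𝕜 := ℂ) (mulL2 a (ofRealL2 v) + mulL2 b (ofRealL2 v)) (a - b)
  change _ = (RCLike.re : ℂ →+ ℝ) _
  rw [← integral_re hi]
  refine integral_congr_ae ?_
  filter_upwards [sqL2_coeFn ha, sqL2_coeFn hb, Lp.coeFn_sub (sqL2 a) (sqL2 b), Lp.coeFn_sub a b,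
    mulL2_coeFn (g := ofRealL2 v) ha, mulL2_coeFn (g := ofRealL2 v) hb, ofRealL2_coeFn v,
    Lp.coeFn_add (mulL2 a (ofRealL2 v)) (mulL2 b (ofRealL2 v))] with x h1 h2 h3 h4 h5 h6 h7 h8
  rw [h3, h4, h8, Pi.sub_apply, Pi.sub_apply, Pi.add_apply, h1, h2, h5, h6, h7]
  simp only [RCLike.inner_apply, Complex.sq_norm, Complex.normSq_apply]
  simp
  ring

theorem inner_mulL2_ofReal_im {v : L2 ℝ} {a : L2 ℂ} {M : ℝ} (ha : ∀ᵐ x, ‖a x‖ ≤ M) :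
    (⟪a, mulL2 a (ofRealL2 v)⟫_ℂ).im = 0 := by
  rw [L2.inner_def]
  have hi := L2.integrable_inner (𝕜 := ℂ) a (mulL2 a (ofRealL2 v))
  change (RCLike.im : ℂ →+ ℝ) _ = _
  rw [← integral_im hi, ← integral_zero ℝ ℝ]
  refine integral_congr_ae ?_
  filter_upwards [mulL2_coeFn (g := ofRealL2 v) ha, ofRealL2_coeFn v] with x h1 h2
  rw [h1, h2]
  simp only [RCLike.inner_apply]
  simp
  ring

end Products

/-! ### Duhamel's formula in the interaction picture -/

noncomputable section Conservation

open scoped InnerProductSpace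

theorem HasDerivAt.norm_sq_L2 {W : ℝ → L2 ℂ} {W' : L2 ℂ} {t : ℝ} (h : HasDerivAt W W' t) :
    HasDerivAt (fun s => ‖W s‖ ^ 2) (2 * (⟪W t, W'⟫_ℂ).re) t := by
  have h1 := h.inner ℂ h
  have h2 := Complex.reCLM.hasFDerivAt.comp_hasDerivAt t h1
  have e : ∀ s, Complex.reCLM ⟪W s, W s⟫_ℂ = ‖W s‖ ^ 2 := fun s =>
    inner_self_eq_norm_sq (𝕜 := ℂ) (W s)
  have e2 : Complex.reCLM (⟪W t, W'⟫_ℂ + ⟪W', W t⟫_ℂ) = 2 * (⟪W t, W'⟫_ℂ).re := by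
    have : (⟪W', W t⟫_ℂ).re = (⟪W t, W'⟫_ℂ).re := inner_re_symm (𝕜 := ℂ) W' (W t)
    simp [this]
    ring
  rw [e2] at h2
  exact h2.congr_of_eventuallyEq (Eventually.of_forall fun s => (e s).symm)

/-- The function `f₀ - i ∫₀ᵗ S(-s) F(s) ds`. Its image under `S(t)` is the solution of
`i ∂ₜf + ½ ∂ₓ²f = F` with initial value `f₀`; unlike that solution, it is differentiable in `L²` as
a function of `t` without any regularity of `f₀` in `x`. -/
def interactionProfile (f₀ : L2 ℂ) (F : ℝ → L2 ℂ) (t : ℝ) : L2 ℂ :=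
  f₀ - Complex.I • ∫ s in (0 : ℝ)..t, schrodingerGroup (-s) (F s)

theorem hasDerivAt_interactionProfile (f₀ : L2 ℂ) {F : ℝ → L2 ℂ} (hF : Continuous F) (t : ℝ) :
    HasDerivAt (interactionProfile f₀ F) (-(Complex.I • schrodingerGroup (-t) (F t))) t := by
  have hc := continuous_schrodingerGroup continuous_neg hF
  have h := intervalIntegral.integral_hasDerivAt_right (hc.intervalIntegrable 0 t)
    (hc.stronglyMeasurableAtFilter _ _) hc.continuousAt
  exact (h.const_smul Complex.I).const_sub f₀

theorem schrodingerGroup_interactionProfile (f₀ : L2 ℂ) {F : ℝ → L2 ℂ} (hF : Continuous F)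
    (t : ℝ) : schrodingerGroup t (interactionProfile f₀ F t)
      = schrodingerGroup t f₀ - Complex.I • ∫ s in (0 : ℝ)..t, schrodingerGroup (t - s) (F s) := by
  have hc := continuous_schrodingerGroup continuous_neg hF
  rw [interactionProfile, schrodingerGroup_sub_right, schrodingerGroup_smul]
  congr 2
  have := (schrodingerIsometry t).toContinuousLinearMap.intervalIntegral_comp_comm
    (hc.intervalIntegrable (μ := volume) 0 t)
  refine Eq.trans this.symm (intervalIntegral.integral_congr fun s _ => ?_)
  change schrodingerGroup t (schrodingerGroup (-s) (F s)) = _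
  rw [← schrodingerGroup_add, sub_eq_add_neg]

/-- The rate of change of the mass of a solution of `i ∂ₜf + ½ ∂ₓ²f = F`. -/
theorem hasDerivAt_norm_sq_interactionProfile (f₀ : L2 ℂ) {F : ℝ → L2 ℂ} (hF : Continuous F)
    (t : ℝ) : HasDerivAt (fun s => ‖interactionProfile f₀ F s‖ ^ 2)
      (2 * (⟪schrodingerGroup t (interactionProfile f₀ F t), F t⟫_ℂ).im) t := by
  have h := (hasDerivAt_interactionProfile f₀ hF t).norm_sq_L2
  have e : ⟪interactionProfile f₀ F t, -(Complex.I • schrodingerGroup (-t) (F t))⟫_ℂ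
      = -(Complex.I * ⟪schrodingerGroup t (interactionProfile f₀ F t), F t⟫_ℂ) := by
    rw [inner_neg_right, inner_smul_right, ← inner_schrodingerGroup t, ← schrodingerGroup_add,
      add_neg_cancel, schrodingerGroup_zero]
  rw [e] at h
  simpa using h

theorem HasWeakDeriv.sub {f f' g g' : L2 ℂ} (hf : HasWeakDeriv f f') (hg : HasWeakDeriv g g') :
    HasWeakDeriv (f - g) (f' - g') := by
  have := hf.add (hg.smul (-1))
  simpa [sub_eq_add_neg] using this

theorem HasWeakDeriv.interactionProfile {f₀ f₀' : L2 ℂ} {F F' : ℝ → L2 ℂ}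
    (h₀ : HasWeakDeriv f₀ f₀') (h : ∀ s, HasWeakDeriv (F s) (F' s)) (hF : Continuous F)
    (hF' : Continuous F') (t : ℝ) :
    HasWeakDeriv (interactionProfile f₀ F t) (interactionProfile f₀' F' t) := by
  refine h₀.sub (HasWeakDeriv.smul _
    (HasWeakDeriv.intervalIntegral (fun s _ => (h s).schrodingerGroup _) ?_ ?_))
  · exact (continuous_schrodingerGroup continuous_neg hF).intervalIntegrable _ _
  · exact (continuous_schrodingerGroup continuous_neg hF').intervalIntegrable _ _

/-- The weak form of `∂ₜf = (i/2) ∂ₓ²f - i F` for `f(t) = S(t) (f₀ - i ∫₀ᵗ S(-s) F(s) ds)`, paired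
with a test function which may vary with `t`, but only continuously in `H¹`. -/
theorem tendsto_inner_slope_interactionProfile {f₀ f₀' : L2 ℂ} {F F' : ℝ → L2 ℂ}
    (h₀ : HasWeakDeriv f₀ f₀') (h : ∀ s, HasWeakDeriv (F s) (F' s)) (hF : Continuous F)
    (hF' : Continuous F') (t : ℝ) {g g' : L2 ℂ} (hg : HasWeakDeriv g g') {r r' : ℝ → L2 ℂ}
    (hr : ∀ᶠ k in 𝓝[>] 0, HasWeakDeriv (r k) (r' k)) (hr0 : Tendsto r (𝓝[>] 0) (𝓝 0))
    (hr0' : Tendsto r' (𝓝[>] 0) (𝓝 0)) :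
    Tendsto (fun k : ℝ => (k : ℂ)⁻¹ * ⟪g + r k,
      schrodingerGroup (t + k) (interactionProfile f₀ F (t + k))
        - schrodingerGroup t (interactionProfile f₀ F t)⟫_ℂ) (𝓝[>] 0)
      (𝓝 (-(Complex.I / 2) * ⟪g', schrodingerGroup t (interactionProfile f₀' F' t)⟫_ℂ
        - Complex.I * ⟪g, F t⟫_ℂ)) := by
  set W := interactionProfile f₀ F
  set W' := interactionProfile f₀' F'
  have hW : HasWeakDeriv (schrodingerGroup t (W t)) (schrodingerGroup t (W' t)) :=
    (h₀.interactionProfile h hF hF' t).schrodingerGroup t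
  have hslope : Tendsto (fun k : ℝ => (k : ℂ)⁻¹ • (W (t + k) - W t)) (𝓝[>] 0)
      (𝓝 (-(Complex.I • schrodingerGroup (-t) (F t)))) := by
    refine (hasDerivAt_interactionProfile f₀ hF t).tendsto_slope_zero_right.congr fun k => ?_
    rw [← Complex.ofReal_inv, Complex.coe_smul]
    rfl
  have hS : Tendsto (fun k : ℝ => schrodingerGroup (t + k) ((k : ℂ)⁻¹ • (W (t + k) - W t)))
      (𝓝[>] 0) (𝓝 (-(Complex.I • F t))) := by
    have e : -(Complex.I • F t)
        = schrodingerGroup (t + 0) (-(Complex.I • schrodingerGroup (-t) (F t))) := by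
      rw [← smul_neg, ← smul_neg, schrodingerGroup_smul, add_zero,
        show -schrodingerGroup (-t) (F t) = schrodingerGroup (-t) (-F t) from
          ((schrodingerIsometry (-t)).map_neg _).symm, ← schrodingerGroup_add, add_neg_cancel,
        schrodingerGroup_zero]
    rw [e]
    have h1 : Tendsto (fun k : ℝ => schrodingerGroup (t + k)
        (-(Complex.I • schrodingerGroup (-t) (F t)))) (𝓝[>] 0)
        (𝓝 (schrodingerGroup (t + 0) (-(Complex.I • schrodingerGroup (-t) (F t))))) :=
      (((continuous_schrodingerGroup_left _).comp (continuous_const.add continuous_id)).tendsto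
        (0 : ℝ)).mono_left nhdsWithin_le_nhds
    have h2 : Tendsto (fun k : ℝ => schrodingerGroup (t + k) ((k : ℂ)⁻¹ • (W (t + k) - W t))
        - schrodingerGroup (t + k) (-(Complex.I • schrodingerGroup (-t) (F t))))
        (𝓝[>] 0) (𝓝 0) := by
      rw [tendsto_zero_iff_norm_tendsto_zero]
      simp_rw [← schrodingerGroup_sub_right, norm_schrodingerGroup]
      exact tendsto_iff_norm_sub_tendsto_zero.1 hslope
    simpa using h2.add h1
  have hgr : Tendsto (fun k => g + r k) (𝓝[>] 0) (𝓝 g) := by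
    simpa using hr0.const_add g
  have l1 := hgr.inner (𝕜 := ℂ) hS
  have l2 := tendsto_inner_schrodingerGroup_sub hW hg
  have l3 : Tendsto (fun k : ℝ => (k : ℂ)⁻¹ * ⟪r k, schrodingerGroup k (schrodingerGroup t (W t))
      - schrodingerGroup t (W t)⟫_ℂ) (𝓝[>] 0) (𝓝 0) := by
    refine squeeze_zero_norm' (a := fun k => ‖schrodingerGroup t (W' t)‖ * ‖r' k‖) ?_ ?_
    · filter_upwards [hr, self_mem_nhdsWithin] with k hk hk0
      exact norm_inner_schrodingerGroup_sub_le hW hk hk0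
    · simpa using hr0'.norm.const_mul ‖schrodingerGroup t (W' t)‖
  have l4 := (l2.add l3).add l1
  have e : -(Complex.I / 2) * ⟪g', schrodingerGroup t (W' t)⟫_ℂ + 0 + ⟪g, -(Complex.I • F t)⟫_ℂ
      = -(Complex.I / 2) * ⟪g', schrodingerGroup t (W' t)⟫_ℂ - Complex.I * ⟪g, F t⟫_ℂ := by
    rw [inner_neg_right, inner_smul_right]
    ring
  rw [e] at l4
  refine l4.congr fun k => ?_
  have e2 : schrodingerGroup (t + k) (W (t + k)) - schrodingerGroup t (W t)
      = schrodingerGroup (t + k) (W (t + k) - W t)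
        + (schrodingerGroup k (schrodingerGroup t (W t)) - schrodingerGroup t (W t)) := by
    rw [← schrodingerGroup_add, schrodingerGroup_sub_right, add_comm k t]
    abel
  rw [e2, schrodingerGroup_smul, inner_smul_right, inner_add_left, inner_add_left,
    inner_add_right, inner_add_right]
  ring

end Conservation

/-! ### Mass and energy of the Schrödinger-Debye system -/

noncomputable section Energy

open scoped InnerProductSpace

/-- The coupling term `u v`. -/
def coupling (u : H1 ℂ) (v : H1 ℝ) : L2 ℂ := mulL2 u.fn v.ofReal.fn

/-- The weak derivative of the coupling term `u v`. -/
def couplingDeriv (u : H1 ℂ) (v : H1 ℝ) : L2 ℂ :=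
  mulL2 v.ofReal.fn u.dx + mulL2 u.fn v.ofReal.dx

theorem hasWeakDeriv_coupling (u : H1 ℂ) (v : H1 ℝ) :
    HasWeakDeriv (coupling u v) (couplingDeriv u v) := u.hasWeakDeriv_mulL2 v.ofReal

theorem toL2_eq_coupling (u : H1 ℂ) (v : H1 ℝ) :
    toL2 (fun x => u.fn x * (v.fn x : ℂ)) = coupling u v := by
  refine toL2_congr ?_
  filter_upwards [ofRealL2_coeFn v.fn] with x hx
  rw [H1.ofReal_fn, hx]

theorem continuous_coupling {u : ℝ → H1 ℂ} {v : ℝ → H1 ℝ} (hu : Continuous u)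
    (hv : Continuous v) : Continuous fun t => coupling (u t) (v t) := by
  rw [← continuousOn_univ] at *
  exact continuousOn_mulL2 hu (H1.continuous_fn.comp_continuousOn
    (H1.continuous_ofReal.comp_continuousOn hv))

theorem continuous_couplingDeriv {u : ℝ → H1 ℂ} {v : ℝ → H1 ℝ} (hu : Continuous u)
    (hv : Continuous v) : Continuous fun t => couplingDeriv (u t) (v t) := by
  rw [← continuousOn_univ] at *
  have hv' := H1.continuous_ofReal.comp_continuousOn hv
  exact (continuousOn_mulL2 hv' (H1.continuous_dx.comp_continuousOn hu)).add
    (continuousOn_mulL2 hu (H1.continuous_dx.comp_continuousOn hv'))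

theorem norm_coupling_le (u : H1 ℂ) (v : H1 ℝ) : ‖coupling u v‖ ≤ 4 * ‖v.ofReal‖ * ‖u‖ := by
  rw [coupling, mulL2_comm]
  exact (norm_mulL2_le v.ofReal.ae_norm_le).trans
    (mul_le_mul_of_nonneg_left u.norm_fn_le (by positivity))

theorem norm_couplingDeriv_le (u : H1 ℂ) (v : H1 ℝ) :
    ‖couplingDeriv u v‖ ≤ 8 * ‖v.ofReal‖ * ‖u‖ := by
  have h1 := norm_mulL2_le (g := u.dx) v.ofReal.ae_norm_le
  have h2 := norm_mulL2_le (g := v.ofReal.dx) u.ae_norm_le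
  have h3 := mul_le_mul_of_nonneg_left u.norm_dx_le (by positivity : 0 ≤ 4 * ‖v.ofReal‖)
  have h4 := mul_le_mul_of_nonneg_left v.ofReal.norm_dx_le (by positivity : 0 ≤ 4 * ‖u‖)
  exact (norm_add_le _ _).trans (by linarith)

/-- A function on the half line, extended to negative times by its value at `0`: the calculus of
integrals with a variable end point is then available at every time. -/
theorem continuous_clamp {E : Type*} [TopologicalSpace E] {f : ℝ → E}
    (h : ContinuousOn f (Ici 0)) : Continuous fun s => f (max s 0) :=
  h.comp_continuous (by fun_prop) fun s => le_max_right s 0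

theorem hasDerivWithinAt_Ici_iff_tendsto {E : Type*} [NormedAddCommGroup E] [NormedSpace ℝ E]
    {f : ℝ → E} {f' : E} {t : ℝ} : HasDerivWithinAt f f' (Ici t) t ↔
      Tendsto (fun k : ℝ => k⁻¹ • (f (t + k) - f t)) (𝓝[>] 0) (𝓝 f') := by
  have e : 𝓝[>] t = map (fun k => t + k) (𝓝[>] 0) := by
    rw [map_add_left_nhdsGT, add_zero]
  rw [← hasDerivWithinAt_Ioi_iff_Ici, hasDerivWithinAt_iff_tendsto_slope' self_notMem_Ioi, e,
    tendsto_map'_iff]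
  simp [Function.comp_def, slope_def_module]

/-- The energy `∫ (|∂ₓu|² + 2 v |u|² + v²) dx` of the focusing Schrödinger-Debye system, in terms of
norms and inner products of `L²`. -/
def debyeEnergy (u : H1 ℂ) (v : H1 ℝ) : ℝ :=
  ‖u.dx‖ ^ 2 + 2 * ⟪v.fn, sqL2 u.fn⟫_ℝ + ‖v.fn‖ ^ 2

/-- The solution of `τ ∂ₜv + v = lam Q` by variation of constants. -/
theorem hasDerivAt_relaxation {lam τ : ℝ} (hτ : τ ≠ 0) (v₀ : L2 ℝ) {Q : ℝ → L2 ℝ}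
    (hQ : Continuous Q) (t : ℝ) :
    HasDerivAt (fun t => Real.exp (-t / τ) • (v₀ + (lam / τ) • ∫ s in (0 : ℝ)..t,
        Real.exp (s / τ) • Q s))
      (τ⁻¹ • (lam • Q t - Real.exp (-t / τ) • (v₀ + (lam / τ) • ∫ s in (0 : ℝ)..t,
        Real.exp (s / τ) • Q s))) t := by
  have hc : Continuous fun s => Real.exp (s / τ) • Q s := by fun_prop
  have h1 := ((intervalIntegral.integral_hasDerivAt_right (hc.intervalIntegrable 0 t)
    (hc.stronglyMeasurableAtFilter _ _) hc.continuousAt).const_smul (lam / τ)).const_add v₀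
  have h2 : HasDerivAt (fun t : ℝ => Real.exp (-t / τ)) (Real.exp (-t / τ) * (-1 / τ)) t :=
    (((hasDerivAt_id t).neg).div_const τ).exp
  refine (h2.smul h1).congr_deriv ?_
  rw [smul_smul, smul_smul, smul_sub, smul_smul, smul_smul, sub_eq_add_neg, ← neg_smul]
  simp only [Pi.smul_apply]
  congr 2
  · rw [show -t / τ = -(t / τ) by ring, Real.exp_neg]
    have := Real.exp_ne_zero (t / τ)
    field_simp
  · ring

namespace IsSDSolution

variable {lam τ : ℝ} {u₀ : H1 ℂ} {v₀ : H1 ℝ} {u : ℝ → H1 ℂ} {v : ℝ → H1 ℝ}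

theorem continuous_source (h : IsSDSolution lam τ u₀ v₀ u v) :
    Continuous fun s => coupling (u (max s 0)) (v (max s 0)) :=
  continuous_coupling (continuous_clamp h.continuousOn_u) (continuous_clamp h.continuousOn_v)

theorem continuous_sourceDeriv (h : IsSDSolution lam τ u₀ v₀ u v) :
    Continuous fun s => couplingDeriv (u (max s 0)) (v (max s 0)) :=
  continuous_couplingDeriv (continuous_clamp h.continuousOn_u)
    (continuous_clamp h.continuousOn_v)

/-- A solution in the interaction picture. -/
theorem fn_eq (h : IsSDSolution lam τ u₀ v₀ u v) {t : ℝ} (ht : 0 ≤ t) :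
    (u t).fn = schrodingerGroup t
      (interactionProfile u₀.fn (fun s => coupling (u (max s 0)) (v (max s 0))) t) := by
  rw [schrodingerGroup_interactionProfile _ h.continuous_source, h.eq_u t ht]
  congr 2
  refine intervalIntegral.integral_congr fun s hs => ?_
  rw [uIcc_of_le ht] at hs
  simp only [toL2_eq_coupling, max_eq_left hs.1]

/-- The derivative `∂ₓu` solves the differentiated equation. -/
theorem dx_eq (h : IsSDSolution lam τ u₀ v₀ u v) {t : ℝ} (ht : 0 ≤ t) :
    (u t).dx = schrodingerGroup t
      (interactionProfile u₀.dx (fun s => couplingDeriv (u (max s 0)) (v (max s 0))) t) := by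
  refine (u t).hasWeakDeriv.unique ?_
  rw [h.fn_eq ht]
  exact (u₀.hasWeakDeriv.interactionProfile (fun s => hasWeakDeriv_coupling _ _)
    h.continuous_source h.continuous_sourceDeriv t).schrodingerGroup t

theorem fn_zero (h : IsSDSolution lam τ u₀ v₀ u v) : (u 0).fn = u₀.fn := by
  simpa [schrodingerGroup_zero] using h.eq_u 0 le_rfl

theorem dx_zero (h : IsSDSolution lam τ u₀ v₀ u v) : (u 0).dx = u₀.dx :=
  (u 0).hasWeakDeriv.unique (h.fn_zero ▸ u₀.hasWeakDeriv)

theorem v_fn_zero (h : IsSDSolution lam τ u₀ v₀ u v) : (v 0).fn = v₀.fn := by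
  simpa using h.eq_v 0 le_rfl

/-- Conservation of mass. -/
theorem norm_fn_eq (h : IsSDSolution lam τ u₀ v₀ u v) {t : ℝ} (ht : 0 ≤ t) :
    ‖(u t).fn‖ = ‖u₀.fn‖ := by
  set N : ℝ → L2 ℂ := fun s => coupling (u (max s 0)) (v (max s 0)) with hN
  have hd := hasDerivAt_norm_sq_interactionProfile u₀.fn h.continuous_source
  have hc : ∀ s ∈ Icc 0 t, ‖interactionProfile u₀.fn N s‖ ^ 2
      = ‖interactionProfile u₀.fn N 0‖ ^ 2 := by
    refine constant_of_has_deriv_right_zero (fun s _ => (hd s).continuousAt.continuousWithinAt)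
      fun s hs => ?_
    have := (hd s).hasDerivWithinAt (s := Ici s)
    rwa [← h.fn_eq hs.1, max_eq_left hs.1, coupling, H1.ofReal_fn,
      inner_mulL2_ofReal_im (u s).ae_norm_le, mul_zero] at this
  have h1 := hc t ⟨ht, le_rfl⟩
  have h2 : interactionProfile u₀.fn N 0 = u₀.fn := by simp [interactionProfile]
  rw [h2] at h1
  rw [h.fn_eq ht, norm_schrodingerGroup]
  exact (pow_left_inj₀ (norm_nonneg _) (norm_nonneg _) two_ne_zero).1 h1

/-- The equation for `v` with the factor `e^{-t/τ}` taken out of the integral. -/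
theorem v_fn_eq (h : IsSDSolution lam τ u₀ v₀ u v) {t : ℝ} (ht : 0 ≤ t) :
    (v t).fn = Real.exp (-t / τ) • (v₀.fn + (lam / τ) • ∫ s in (0 : ℝ)..t,
        Real.exp (s / τ) • sqL2 (u (max s 0)).fn) := by
  rw [h.eq_v t ht, smul_add, smul_comm (Real.exp (-t / τ)) (lam / τ)]
  congr 2
  rw [← intervalIntegral.integral_smul]
  refine intervalIntegral.integral_congr fun s hs => ?_
  rw [uIcc_of_le ht] at hs
  simp only [max_eq_left hs.1]
  rw [smul_smul, ← Real.exp_add, show -(t - s) / τ = -t / τ + s / τ by ring]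
  rfl

theorem hasDerivWithinAt_v_fn (h : IsSDSolution lam τ u₀ v₀ u v) (hτ : τ ≠ 0) {t : ℝ}
    (ht : 0 ≤ t) : HasDerivWithinAt (fun s => (v s).fn)
      (τ⁻¹ • (lam • sqL2 (u t).fn - (v t).fn)) (Ici t) t := by
  have hQ : Continuous fun s => sqL2 (u (max s 0)).fn :=
    continuous_clamp (continuousOn_sqL2 h.continuousOn_u)
  have := (hasDerivAt_relaxation (lam := lam) hτ v₀.fn hQ t).hasDerivWithinAt (s := Ici t)
  rw [← h.v_fn_eq ht, max_eq_left ht] at this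
  exact this.congr (fun s hs => h.v_fn_eq (ht.trans hs)) (h.v_fn_eq ht)

/-- The rate of change of the kinetic energy `∫ |∂ₓu|²`. -/
theorem hasDerivWithinAt_norm_sq_dx (h : IsSDSolution lam τ u₀ v₀ u v) {t : ℝ} (ht : 0 ≤ t) :
    HasDerivWithinAt (fun s => ‖(u s).dx‖ ^ 2)
      (2 * (⟪(u t).dx, couplingDeriv (u t) (v t)⟫_ℂ).im) (Ici t) t := by
  have := (hasDerivAt_norm_sq_interactionProfile u₀.dx h.continuous_sourceDeriv t).hasDerivWithinAt
    (s := Ici t)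
  rw [← h.dx_eq ht, max_eq_left ht] at this
  refine this.congr (fun s hs => ?_) ?_
  · rw [h.dx_eq (ht.trans hs), norm_schrodingerGroup]
  · rw [h.dx_eq ht, norm_schrodingerGroup]

/-- The rate of change of the interaction energy `∫ v |u|²`. The term with `∂ₓu` is half of the rate
of change of the kinetic energy, with the opposite sign. -/
theorem hasDerivWithinAt_inner (h : IsSDSolution lam τ u₀ v₀ u v) (hτ : τ ≠ 0) {t : ℝ}
    (ht : 0 ≤ t) : HasDerivWithinAt (fun s => ⟪(v s).fn, sqL2 (u s).fn⟫_ℝ)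
      (⟪τ⁻¹ • (lam • sqL2 (u t).fn - (v t).fn), sqL2 (u t).fn⟫_ℝ
        - (⟪(u t).dx, couplingDeriv (u t) (v t)⟫_ℂ).im) (Ici t) t := by
  have hmem : ∀ᶠ k : ℝ in 𝓝[>] 0, 0 ≤ t + k := by
    filter_upwards [self_mem_nhdsWithin] with k hk
    exact add_nonneg ht (le_of_lt hk)
  have hshift : Tendsto (fun k : ℝ => t + k) (𝓝[>] 0) (𝓝[≥] t) := by
    refine tendsto_nhdsWithin_iff.2 ⟨?_, ?_⟩
    · have : Tendsto (fun k : ℝ => t + k) (𝓝 0) (𝓝 (t + 0)) :=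
        (continuous_const.add continuous_id).tendsto 0
      rw [add_zero] at this
      exact this.mono_left nhdsWithin_le_nhds
    · filter_upwards [self_mem_nhdsWithin] with k hk
      exact le_add_of_nonneg_right (le_of_lt (mem_Ioi.1 hk))
  have hu : Tendsto (fun k : ℝ => u (t + k)) (𝓝[>] 0) (𝓝 (u t)) :=
    ((h.continuousOn_u t ht).mono (Ici_subset_Ici.2 ht)).tendsto.comp hshift
  have hQ : Tendsto (fun k : ℝ => sqL2 (u (t + k)).fn) (𝓝[>] 0) (𝓝 (sqL2 (u t).fn)) :=
    ((continuousOn_sqL2 h.continuousOn_u t ht).mono (Ici_subset_Ici.2 ht)).tendsto.comp hshift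
  have hv : Tendsto (fun k : ℝ => k⁻¹ • ((v (t + k)).fn - (v t).fn)) (𝓝[>] 0)
      (𝓝 (τ⁻¹ • (lam • sqL2 (u t).fn - (v t).fn))) := by
    exact (hasDerivWithinAt_Ici_iff_tendsto (f := fun s => (v s).fn)).1
      (h.hasDerivWithinAt_v_fn hτ ht)
  have l1 := hv.inner (𝕜 := ℝ) hQ
  -- The increment of `|u|²` over `[t, t + k]`, paired with the frozen potential `v t`, is the
  -- pairing of the increment of `u` with `(u (t + k) + u t) v t = 2 (u t) (v t) + r k`.
  set r : ℝ → L2 ℂ := fun k => coupling (u (t + k) - u t) (v t)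
  set r' : ℝ → L2 ℂ := fun k => couplingDeriv (u (t + k) - u t) (v t)
  have hdu : Tendsto (fun k : ℝ => ‖u (t + k) - u t‖) (𝓝[>] 0) (𝓝 0) :=
    tendsto_iff_norm_sub_tendsto_zero.1 hu
  have hr : Tendsto r (𝓝[>] 0) (𝓝 0) :=
    squeeze_zero_norm (fun k => norm_coupling_le _ _) (by simpa using hdu.const_mul _)
  have hr' : Tendsto r' (𝓝[>] 0) (𝓝 0) :=
    squeeze_zero_norm (fun k => norm_couplingDeriv_le _ _) (by simpa using hdu.const_mul _)
  have l2 := tendsto_inner_slope_interactionProfile u₀.hasWeakDeriv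
    (fun s => hasWeakDeriv_coupling (u (max s 0)) (v (max s 0)))
    h.continuous_source h.continuous_sourceDeriv t
    (HasWeakDeriv.smul 2 (hasWeakDeriv_coupling (u t) (v t)))
    (Eventually.of_forall fun k => hasWeakDeriv_coupling (u (t + k) - u t) (v t)) hr hr'
  rw [← h.dx_eq ht, max_eq_left ht] at l2
  have l3 := ((Complex.continuous_re.tendsto _).comp l2)
  have l4 := l1.add l3
  have e1 : (-(Complex.I / 2) * ⟪(2 : ℂ) • couplingDeriv (u t) (v t), (u t).dx⟫_ℂ
      - Complex.I * ⟪(2 : ℂ) • coupling (u t) (v t), coupling (u t) (v t)⟫_ℂ).re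
      = -(⟪(u t).dx, couplingDeriv (u t) (v t)⟫_ℂ).im := by
    have i1 : ((‖coupling (u t) (v t)‖ : ℂ) ^ 2).im = 0 := by
      rw [← Complex.ofReal_pow, Complex.ofReal_im]
    have i2 : (⟪couplingDeriv (u t) (v t), (u t).dx⟫_ℂ).im
        = -(⟪(u t).dx, couplingDeriv (u t) (v t)⟫_ℂ).im := inner_im_symm (𝕜 := ℂ) _ _
    rw [inner_smul_left, inner_smul_left, ← i2, map_ofNat]
    simp [i1]
  rw [e1, ← sub_eq_add_neg] at l4
  refine hasDerivWithinAt_Ici_iff_tendsto.2 (l4.congr' ?_)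
  filter_upwards [hmem] with k hk
  have e2 : coupling (u (t + k) - u t) (v t) = mulL2 (u (t + k)).fn (ofRealL2 (v t).fn)
      - coupling (u t) (v t) := by
    rw [coupling, H1.fn_sub, mulL2_sub_left (u (t + k)).ae_norm_le (u t).ae_norm_le]
    rfl
  have e3 := inner_sqL2_sub (v := (v t).fn) (u (t + k)).ae_norm_le (u t).ae_norm_le
  have e4 : (2 : ℂ) • coupling (u t) (v t) + coupling (u (t + k) - u t) (v t)
      = mulL2 (u (t + k)).fn (ofRealL2 (v t).fn) + mulL2 (u t).fn (ofRealL2 (v t).fn) := by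
    rw [e2, two_smul, coupling, H1.ofReal_fn]
    abel
  simp only [Function.comp_apply]
  rw [← h.fn_eq hk, ← h.fn_eq ht, e4, ← Complex.ofReal_inv, Complex.re_ofReal_mul, ← e3]
  simp only [inner_smul_left, inner_sub_left, inner_sub_right, conj_trivial, smul_eq_mul]
  ring

/-- The energy of a solution of the focusing Schrödinger-Debye system does not increase: its rate
of change is `-2 τ⁻¹ ‖v + |u|²‖²`. -/
theorem debyeEnergy_le (h : IsSDSolution (-1) τ u₀ v₀ u v) (hτ : 0 < τ) {t : ℝ} (ht : 0 ≤ t) :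
    debyeEnergy (u t) (v t) ≤ debyeEnergy u₀ v₀ := by
  have h0 : debyeEnergy (u 0) (v 0) = debyeEnergy u₀ v₀ := by
    rw [debyeEnergy, debyeEnergy, h.fn_zero, h.dx_zero, h.v_fn_zero]
  rw [← h0]
  have hcont : ContinuousOn (fun s => debyeEnergy (u s) (v s)) (Icc 0 t) := by
    have hu := h.continuousOn_u.mono (Icc_subset_Ici_self : Icc 0 t ⊆ Ici 0)
    have hv := H1.continuous_fn.comp_continuousOn
      (h.continuousOn_v.mono (Icc_subset_Ici_self : Icc 0 t ⊆ Ici 0))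
    exact (((H1.continuous_dx.comp_continuousOn hu).norm.pow 2).add
      ((hv.inner (𝕜 := ℝ) (continuousOn_sqL2 hu)).const_mul 2)).add (hv.norm.pow 2)
  have hderiv : ∀ s ∈ Ico 0 t, HasDerivWithinAt (fun s => debyeEnergy (u s) (v s))
      (-(2 * τ⁻¹ * ‖(v s).fn + sqL2 (u s).fn‖ ^ 2)) (Ici s) s := by
    intro s hs
    have hv := h.hasDerivWithinAt_v_fn hτ.ne' hs.1
    have h3 := hv.inner ℝ hv
    have h4 := ((h.hasDerivWithinAt_norm_sq_dx hs.1).add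
      ((h.hasDerivWithinAt_inner hτ.ne' hs.1).const_mul 2)).add h3
    have e : ∀ s, debyeEnergy (u s) (v s) = ‖(u s).dx‖ ^ 2 + 2 * ⟪(v s).fn, sqL2 (u s).fn⟫_ℝ
        + ⟪(v s).fn, (v s).fn⟫_ℝ := fun s => by
      rw [debyeEnergy, real_inner_self_eq_norm_sq]
    refine (h4.congr_deriv ?_).congr (fun s _ => e s) (e s)
    rw [← real_inner_self_eq_norm_sq]
    simp only [inner_add_left, inner_add_right, inner_sub_left, inner_sub_right, inner_smul_left,
      inner_smul_right, real_inner_comm (sqL2 (u s).fn) (v s).fn, map_inv₀, conj_trivial,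
      neg_smul, one_smul, inner_neg_left, inner_neg_right]
    ring
  exact image_le_of_deriv_right_le_deriv_boundary hcont hderiv le_rfl continuousOn_const
    (fun s _ => hasDerivWithinAt_const _ _ _)
    (fun s _ => neg_nonpos.2 (by positivity)) ⟨ht, le_rfl⟩

end IsSDSolution

end Energy

/-! ### Bounds uniform in the relaxation time -/

noncomputable section UniformBound

open scoped InnerProductSpace

/-- The interaction energy is controlled by the mass and a small part of the kinetic energy. -/
theorem norm_sqL2_sq_le (u : H1 ℂ) :
    ‖sqL2 u.fn‖ ^ 2 ≤ 4 * (‖u.fn‖ ^ 2 + 1) * (‖u.fn‖ ^ 2) ^ 2 + ‖u.dx‖ ^ 2 / 4 := by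
  -- In the embedding `H¹ ⊂ L^∞` the weight `A = ‖u‖² + 1` makes the coefficient of `‖∂ₓu‖²` at most
  -- `1 / 4` after multiplication by `‖u‖²`.
  have hA : 0 < ‖u.fn‖ ^ 2 + 1 := by positivity
  set m := ‖u.fn‖ ^ 2
  set K := Real.pi * (m + 1) * m + ‖u.dx‖ ^ 2 / (4 * Real.pi * (m + 1)) with hK
  have hm : 0 ≤ m := sq_nonneg _
  have hπ := Real.pi_gt_three
  have hπ4 := Real.pi_le_four
  have hK0 : 0 ≤ K := by positivity
  have h1 : ∀ᵐ x, ‖u.fn x‖ ≤ √K := by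
    filter_upwards [u.hasWeakDeriv.ae_norm_sq_le hA] with x hx
    exact Real.le_sqrt_of_sq_le hx
  have h2 := pow_le_pow_left₀ (norm_nonneg _) (norm_sqL2_le h1) 2
  rw [mul_pow, Real.sq_sqrt hK0] at h2
  refine h2.trans ?_
  have h3 : ‖u.dx‖ ^ 2 / (4 * Real.pi * (m + 1)) * m ≤ ‖u.dx‖ ^ 2 / 4 := by
    rw [div_mul_eq_mul_div, div_le_div_iff₀ (by positivity) (by norm_num)]
    have : m ≤ Real.pi * (m + 1) := by nlinarith
    nlinarith [sq_nonneg ‖u.dx‖, mul_le_mul_of_nonneg_left this (sq_nonneg ‖u.dx‖)]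
  have h4 : Real.pi * ((m + 1) * m * m) ≤ 4 * ((m + 1) * m * m) :=
    mul_le_mul_of_nonneg_right hπ4 (by positivity)
  calc K * m = Real.pi * ((m + 1) * m * m) + ‖u.dx‖ ^ 2 / (4 * Real.pi * (m + 1)) * m := by
        rw [hK]; ring
    _ ≤ 4 * ((m + 1) * m * m) + ‖u.dx‖ ^ 2 / 4 := add_le_add h4 h3
    _ = _ := by ring

/-- Coercivity of the energy at fixed mass. -/
theorem norm_sq_dx_add_norm_sq_le (u : H1 ℂ) (v : H1 ℝ) :
    ‖u.dx‖ ^ 2 + ‖v.fn‖ ^ 2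
      ≤ 2 * debyeEnergy u v + 16 * (‖u.fn‖ ^ 2 + 1) * (‖u.fn‖ ^ 2) ^ 2 := by
  have h1 := norm_sqL2_sq_le u
  have h2 := neg_le_of_abs_le (abs_real_inner_le_norm v.fn (sqL2 u.fn))
  have h3 := sq_nonneg (‖v.fn‖ - 2 * ‖sqL2 u.fn‖)
  rw [debyeEnergy]
  nlinarith

theorem debyeEnergy_le_of_le {u : H1 ℂ} {v : H1 ℝ} {R C : ℝ} (hu : ‖u‖ ≤ R) (hv : ‖v.fn‖ ≤ C) :
    debyeEnergy u v ≤ R ^ 2 + 8 * C * R ^ 2 + C ^ 2 := by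
  have hR : 0 ≤ R := (norm_nonneg _).trans hu
  have hC : 0 ≤ C := (norm_nonneg _).trans hv
  have h1 := (real_inner_le_norm v.fn (sqL2 u.fn))
  have h2 : ‖sqL2 u.fn‖ ≤ 4 * R * R := by
    refine (norm_sqL2_le u.ae_norm_le).trans ?_
    have := u.norm_fn_le
    gcongr
    exact this.trans hu
  have h3 : ‖v.fn‖ * ‖sqL2 u.fn‖ ≤ C * (4 * R * R) := by gcongr
  have h4 : ‖u.dx‖ ^ 2 ≤ R ^ 2 := pow_le_pow_left₀ (norm_nonneg _) (u.norm_dx_le.trans hu) 2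
  have h5 : ‖v.fn‖ ^ 2 ≤ C ^ 2 := pow_le_pow_left₀ (norm_nonneg _) hv 2
  rw [debyeEnergy]
  nlinarith

/-- Solutions of the focusing Schrödinger-Debye system are bounded, uniformly in `τ` and `t`, for
data bounded in `H¹ × L²`. -/
theorem exists_forall_isSDSolution_ae_norm_le (R C : ℝ) : ∃ M : ℝ, 0 ≤ M ∧
    ∀ (τ : ℝ) (u₀ : H1 ℂ) (v₀ : H1 ℝ) (u : ℝ → H1 ℂ) (v : ℝ → H1 ℝ), 0 < τ →
      IsSDSolution (-1) τ u₀ v₀ u v → ‖u₀‖ ≤ R → ‖v₀.fn‖ ≤ C →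
      ∀ t : ℝ, 0 ≤ t → ∀ᵐ x, ‖(u t).fn x‖ ≤ M := by
  set B := R ^ 2 + 2 * (R ^ 2 + 8 * C * R ^ 2 + C ^ 2) + 16 * (R ^ 2 + 1) * (R ^ 2) ^ 2
  refine ⟨4 * √B, by positivity, fun τ u₀ v₀ u v hτ h hu hv t ht => ?_⟩
  have h1 := (h.debyeEnergy_le hτ ht).trans (debyeEnergy_le_of_le hu hv)
  have h2 := norm_sq_dx_add_norm_sq_le (u t) (v t)
  have h3 : ‖(u t).fn‖ ^ 2 ≤ R ^ 2 := by
    rw [h.norm_fn_eq ht]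
    exact pow_le_pow_left₀ (norm_nonneg _) (u₀.norm_fn_le.trans hu) 2
  have h4 : 16 * (‖(u t).fn‖ ^ 2 + 1) * (‖(u t).fn‖ ^ 2) ^ 2 ≤ 16 * (R ^ 2 + 1) * (R ^ 2) ^ 2 := by
    gcongr
  have h5 : ‖u t‖ ≤ √B := by
    refine Real.le_sqrt_of_sq_le ?_
    rw [H1.norm_sq]
    simp only [B]
    nlinarith [sq_nonneg ‖(v t).fn‖]
  filter_upwards [(u t).ae_norm_le] with x hx
  linarith

theorem sdEnergy_neg_one (u : H1 ℂ) (v : H1 ℝ) : sdEnergy (-1) u v = debyeEnergy u v := by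
  have i1 : Integrable (fun x => ‖u.dx x‖ ^ 2) := (Lp.memLp _).integrable_norm_pow (by norm_num)
  have i3 : Integrable (fun x => ‖v.fn x‖ ^ 2) := (Lp.memLp _).integrable_norm_pow (by norm_num)
  have hs := sqL2_coeFn u.ae_norm_le
  have i2 : Integrable (fun x => v.fn x * ‖u.fn x‖ ^ 2) := by
    refine ((Lp.memLp v.fn).integrable_mul (Lp.memLp (sqL2 u.fn))).congr ?_
    filter_upwards [hs] with x hx
    rw [Pi.mul_apply, hx]
  have e2 : ⟪v.fn, sqL2 u.fn⟫_ℝ = ∫ x, v.fn x * ‖u.fn x‖ ^ 2 := by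
    rw [L2.inner_def]
    refine integral_congr_ae ?_
    filter_upwards [hs] with x hx
    rw [hx]
    simp [mul_comm]
  have i12 : Integrable (fun x => ‖u.dx x‖ ^ 2 + 2 * (v.fn x * ‖u.fn x‖ ^ 2)) :=
    i1.add (i2.const_mul 2)
  rw [debyeEnergy, norm_sq_L2_eq_integral, norm_sq_L2_eq_integral, e2, ← integral_const_mul,
    ← integral_add i1 (i2.const_mul 2), ← integral_add i12 i3, sdEnergy]
  refine integral_congr_ae (Eventually.of_forall fun x => ?_)
  simp only [Real.norm_eq_abs, sq_abs]
  ring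

/-- Data of nonpositive energy are bounded in `L²` in terms of the mass. -/
theorem norm_fn_le_of_sdEnergy_nonpos {u : H1 ℂ} {v : H1 ℝ} {R : ℝ} (hu : ‖u‖ ≤ R)
    (h : sdEnergy (-1) u v ≤ 0) : ‖v.fn‖ ≤ √(16 * (R ^ 2 + 1) * (R ^ 2) ^ 2) := by
  rw [sdEnergy_neg_one] at h
  refine Real.le_sqrt_of_sq_le ?_
  have h2 := norm_sq_dx_add_norm_sq_le u v
  have h3 : ‖u.fn‖ ^ 2 ≤ R ^ 2 := pow_le_pow_left₀ (norm_nonneg _) (u.norm_fn_le.trans hu) 2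
  have h4 : 16 * (‖u.fn‖ ^ 2 + 1) * (‖u.fn‖ ^ 2) ^ 2 ≤ 16 * (R ^ 2 + 1) * (R ^ 2) ^ 2 := by
    gcongr
  nlinarith [sq_nonneg ‖u.dx‖]

/-- The closed set of `L²` functions bounded by `M` almost everywhere. -/
theorem isClosed_setOf_ae_norm_le (M : ℝ) : IsClosed {f : L2 ℂ | ∀ᵐ x, ‖f x‖ ≤ M} := by
  refine IsSeqClosed.isClosed fun f g hf hg => ?_
  have h1 : TendstoInMeasure volume (fun n => (f n : ℝ → ℂ)) atTop g :=
    tendstoInMeasure_of_tendsto_Lp hg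
  obtain ⟨ns, -, h2⟩ := h1.exists_seq_tendsto_ae
  have h3 : ∀ᵐ x, ∀ n, ‖f n x‖ ≤ M := ae_all_iff.2 hf
  filter_upwards [h2, h3] with x hx hx'
  exact le_of_tendsto hx.norm (Eventually.of_forall fun n => hx' _)

theorem isClosed_setOf_eLpNorm_top_le (y : ℝ≥0∞) :
    IsClosed {f : L2 ℂ | eLpNorm f ⊤ volume ≤ y} := by
  by_cases hy : y = ⊤
  · simp [hy]
  · convert isClosed_setOf_ae_norm_le y.toReal using 3 with f
    rw [eLpNorm_exponent_top]
    constructor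
    · intro h
      filter_upwards [ae_le_eLpNormEssSup (f := f) (μ := volume)] with x hx
      have := ENNReal.toReal_mono hy (hx.trans h)
      simpa using this
    · intro h
      refine eLpNormEssSup_le_of_ae_enorm_bound ?_
      filter_upwards [h] with x hx
      rw [← ofReal_norm]
      exact ENNReal.ofReal_le_of_le_toReal hx

/-- The `L^∞` norm is lower semicontinuous on `L²`, hence measurable along a continuous curve. -/
theorem measurable_eLpNorm_top {w : ℝ → L2 ℂ} (hw : Continuous w) :
    Measurable fun t => eLpNorm (w t) ⊤ volume :=
  measurable_of_Iic fun y => ((isClosed_setOf_eLpNorm_top_le y).preimage hw).measurableSet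

/-- A square integrable function of time which bounds the `L^∞` norm of the given `L²` solution of
the cubic Schrödinger equation at almost every time. -/
theorem IsNLSSolution.exists_bound {lam : ℝ} {u₀ : L2 ℂ} {u : ℝ → L2 ℂ}
    (h : IsNLSSolution lam u₀ u) (T : ℝ) : ∃ q : ℝ → ℝ, (∀ t, 0 ≤ q t) ∧
      IntegrableOn q (Icc 0 T) ∧ IntegrableOn (fun t => q t ^ 2) (Icc 0 T) ∧
      ∀ᵐ t ∂volume.restrict (Icc 0 T), ∀ᵐ x, ‖u t x‖ ≤ q t := by
  set Q : ℝ → ℝ≥0∞ := fun t => eLpNorm (u (max t 0)) ⊤ volume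
  have hQ : Measurable Q := measurable_eLpNorm_top (continuous_clamp h.continuousOn)
  have hfin : ∫⁻ t in Icc 0 T, Q t ^ 4 < ⊤ := by
    refine lt_of_eq_of_lt (setLIntegral_congr_fun measurableSet_Icc fun t ht => ?_)
      (h.strichartz T)
    simp only [Q, max_eq_left ht.1]
  have hlt : ∀ᵐ t ∂volume.restrict (Icc 0 T), Q t < ⊤ := by
    filter_upwards [ae_lt_top (hQ.pow_const 4) hfin.ne] with t ht
    by_contra hc
    rw [not_lt, top_le_iff] at hc
    simp [hc] at ht
  have h4 : MemLp (fun t => (Q t).toReal) 4 (volume.restrict (Icc 0 T)) := by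
    refine ⟨hQ.ennreal_toReal.aestronglyMeasurable, ?_⟩
    rw [eLpNorm_lt_top_iff_lintegral_rpow_enorm_lt_top (by norm_num) (by norm_num)]
    refine lt_of_eq_of_lt (lintegral_congr_ae ?_) hfin
    filter_upwards [hlt] with t ht
    rw [Real.enorm_of_nonneg ENNReal.toReal_nonneg, ENNReal.ofReal_toReal ht.ne]
    norm_num
  have h2 : MemLp (fun t => (Q t).toReal) 2 (volume.restrict (Icc 0 T)) :=
    h4.mono_exponent (by norm_num)
  refine ⟨fun t => (Q t).toReal, fun t => ENNReal.toReal_nonneg, ?_, ?_, ?_⟩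
  · exact h2.integrable (by norm_num)
  · exact h2.integrable_sq
  · filter_upwards [hlt, ae_restrict_mem measurableSet_Icc] with t ht htm
    filter_upwards [ae_le_eLpNormEssSup (f := u (max t 0)) (μ := volume)] with x hx
    rw [← eLpNorm_exponent_top] at hx
    have := ENNReal.toReal_mono ht.ne hx
    rw [max_eq_left htm.1] at this
    simpa [Q] using this

end UniformBound

/-! ### Relaxation towards the adiabatic state -/

noncomputable section Convergence

open scoped InnerProductSpace

/-- The increments of a continuous function on a compact interval are bounded by an affine function
of the time lag with an arbitrarily small constant term. -/
theorem exists_norm_sub_le_add_mul {E : Type*} [NormedAddCommGroup E] {u : ℝ → E} {T : ℝ}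
    (hu : ContinuousOn u (Icc 0 T)) {δ : ℝ} (hδ : 0 < δ) : ∃ c : ℝ, 0 ≤ c ∧
      ∀ s ∈ Icc 0 T, ∀ r ∈ Icc 0 T, ‖u s - u r‖ ≤ δ + c * |r - s| := by
  obtain ⟨B, hB⟩ := isCompact_Icc.exists_bound_of_continuousOn hu
  have huc := isCompact_Icc.uniformContinuousOn_of_continuous hu
  obtain ⟨η, hη, h⟩ := Metric.uniformContinuousOn_iff.1 huc δ hδ
  refine ⟨2 * |B| / η, by positivity, fun s hs r hr => ?_⟩
  rcases lt_or_ge |r - s| η with hlt | hge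
  · have := h s hs r hr (by rwa [Real.dist_eq, abs_sub_comm])
    rw [dist_eq_norm] at this
    have : 0 ≤ 2 * |B| / η * |r - s| := by positivity
    linarith
  · have h1 : ‖u s - u r‖ ≤ 2 * |B| := by
      refine (norm_sub_le _ _).trans ?_
      linarith [hB s hs, hB r hr, le_abs_self B]
    have h2 : 2 * |B| ≤ 2 * |B| / η * |r - s| := by
      rw [div_mul_eq_mul_div, le_div_iff₀ hη]
      gcongr
    linarith

/-- Against an exponential weight with a large rate, an integrable function has small
convolution, uniformly on a bounded interval. -/
theorem exists_integral_mul_exp_le {k : ℝ → ℝ} {T : ℝ} (hk0 : ∀ t, 0 ≤ k t)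
    (hk : IntegrableOn k (Icc 0 T)) : ∃ L : ℝ, 0 < L ∧ ∀ t ∈ Icc 0 T,
      ∫ s in (0 : ℝ)..t, k s * Real.exp (-L * (t - s)) ≤ 1 / 2 := by
  -- truncate `k` at a level `n` above which little mass remains
  have hlim : Tendsto (fun n : ℕ => ∫ s in Icc 0 T, (k s - min (k s) n)) atTop (𝓝 0) := by
    suffices h : Tendsto (fun n : ℕ => ∫ s in Icc 0 T, (k s - min (k s) n)) atTop
        (𝓝 (∫ s in Icc 0 T, (0 : ℝ))) by simpa only [integral_zero] using h
    refine tendsto_integral_of_dominated_convergence k (fun n => ?_) hk (fun n => ?_) ?_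
    · exact hk.aestronglyMeasurable.sub
        (hk.aestronglyMeasurable.inf aestronglyMeasurable_const)
    · refine Eventually.of_forall fun s => ?_
      have h1 : 0 ≤ min (k s) n := le_min (hk0 s) n.cast_nonneg
      rw [Real.norm_of_nonneg (sub_nonneg.2 (min_le_left _ _))]
      linarith
    · refine Eventually.of_forall fun s => ?_
      refine tendsto_const_nhds.congr' ?_
      filter_upwards [eventually_ge_atTop ⌈k s⌉₊] with n hn
      rw [min_eq_left ((Nat.le_ceil _).trans (by exact_mod_cast hn)), sub_self]
  obtain ⟨n, hn⟩ := (hlim.eventually (eventually_le_nhds (by norm_num : (0 : ℝ) < 1 / 4))).exists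
  refine ⟨4 * (n + 1), by positivity, fun t ht => ?_⟩
  set L : ℝ := 4 * (n + 1) with hL
  have hLpos : 0 < L := by positivity
  have hsub : Ioc 0 t ⊆ Icc 0 T := fun s hs => ⟨hs.1.le, hs.2.trans ht.2⟩
  have hmin : IntegrableOn (fun s => min (k s) n) (Icc 0 T) := by
    refine hk.mono' (hk.aestronglyMeasurable.inf aestronglyMeasurable_const)
      (Eventually.of_forall fun s => ?_)
    rw [Real.norm_of_nonneg (le_min (hk0 s) n.cast_nonneg)]
    exact min_le_left _ _
  have hd : IntegrableOn (fun s => k s - min (k s) n) (Icc 0 T) := hk.sub hmin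
  have hI : IntervalIntegrable (fun s => Real.exp (-L * (t - s))) volume 0 t :=
    Continuous.intervalIntegrable (by fun_prop) _ _
  have hint : ∫ s in (0 : ℝ)..t, Real.exp (-L * (t - s)) ≤ 1 / L := by
    have hderiv : ∀ s ∈ uIcc 0 t, HasDerivAt (fun s => Real.exp (-L * (t - s)) / L)
        (Real.exp (-L * (t - s))) s := fun s _ => by
      have h1 : HasDerivAt (fun s => -L * (t - s)) L s := by
        have := ((hasDerivAt_id s).const_sub t).const_mul (-L)
        simpa using this
      have := h1.exp.div_const L
      rwa [mul_div_assoc, div_self hLpos.ne', mul_one] at this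
    rw [intervalIntegral.integral_eq_sub_of_hasDerivAt hderiv hI]
    simp only [sub_self, mul_zero, Real.exp_zero]
    have : 0 ≤ Real.exp (-L * (t - 0)) / L := by positivity
    linarith
  have h1 : ∫ s in (0 : ℝ)..t, k s * Real.exp (-L * (t - s))
      ≤ ∫ s in (0 : ℝ)..t, ((k s - min (k s) n) + n * Real.exp (-L * (t - s))) := by
    refine intervalIntegral.integral_mono_on ht.1 ?_ ?_ fun s hs => ?_
    · refine IntervalIntegrable.mul_continuousOn ?_ (by fun_prop)
      exact (intervalIntegrable_iff_integrableOn_Ioc_of_le ht.1).2 (hk.mono_set hsub)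
    · exact ((intervalIntegrable_iff_integrableOn_Ioc_of_le ht.1).2 (hd.mono_set hsub)).add
        (hI.const_mul _)
    · have he1 : Real.exp (-L * (t - s)) ≤ 1 := Real.exp_le_one_iff.2 (by nlinarith [hs.2])
      have he0 := Real.exp_pos (-L * (t - s))
      have h2 : 0 ≤ k s - min (k s) n := sub_nonneg.2 (min_le_left _ _)
      have h3 : min (k s) n ≤ n := min_le_right _ _
      nlinarith
  refine h1.trans ?_
  have h2 : ∫ s in (0 : ℝ)..t, (k s - min (k s) n) ≤ 1 / 4 := by
    rw [intervalIntegral.integral_of_le ht.1]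
    refine (setIntegral_mono_set hd (Eventually.of_forall fun s =>
      sub_nonneg.2 (min_le_left _ _)) hsub.eventuallyLE).trans hn
  rw [intervalIntegral.integral_add
    ((intervalIntegrable_iff_integrableOn_Ioc_of_le ht.1).2 (hd.mono_set hsub)) (hI.const_mul _),
    intervalIntegral.integral_const_mul]
  have h3 : (n : ℝ) * ∫ s in (0 : ℝ)..t, Real.exp (-L * (t - s)) ≤ 1 / 4 := by
    calc _ ≤ (n : ℝ) * (1 / L) := by gcongr
      _ ≤ 1 / 4 := by
        rw [hL, mul_one_div, div_le_div_iff₀ (by positivity) (by norm_num)]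
        linarith
  linarith

/-- The relaxation kernel acting on an affine function of the time lag. -/
theorem integral_relaxation_kernel {τ : ℝ} (hτ : 0 < τ) (r b c : ℝ) :
    τ⁻¹ * ∫ s in (0 : ℝ)..r, Real.exp (-(r - s) / τ) * (b + c * (r - s))
      = b + c * τ - Real.exp (-r / τ) * (b + c * τ + c * r) := by
  have hderiv : ∀ s ∈ uIcc 0 r, HasDerivAt
      (fun s => Real.exp (-(r - s) / τ) * (b + c * τ + c * (r - s)) * τ)
      (Real.exp (-(r - s) / τ) * (b + c * (r - s))) s := fun s _ => by
    have h0 : HasDerivAt (fun s => r - s) (-1) s := by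
      simpa using (hasDerivAt_id s).const_sub r
    have h1 : HasDerivAt (fun s => Real.exp (-(r - s) / τ))
        (Real.exp (-(r - s) / τ) * (1 / τ)) s := by
      have := (h0.neg.div_const τ).exp
      simpa using this
    have h2 := (h1.mul ((h0.const_mul c).const_add (b + c * τ))).mul_const τ
    refine h2.congr_deriv ?_
    field_simp
    ring
  rw [intervalIntegral.integral_eq_sub_of_hasDerivAt hderiv
    (Continuous.intervalIntegrable (by fun_prop) _ _)]
  simp only [sub_self, sub_zero, neg_zero, zero_div, Real.exp_zero, mul_zero, add_zero, one_mul]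
  field_simp

theorem IsSDSolution.v_fn_eq_integral {lam τ : ℝ} {u₀ : H1 ℂ} {v₀ : H1 ℝ} {u : ℝ → H1 ℂ}
    {v : ℝ → H1 ℝ} (h : IsSDSolution lam τ u₀ v₀ u v) {r : ℝ} (hr : 0 ≤ r) :
    (v r).fn = Real.exp (-r / τ) • v₀.fn
      + (lam / τ) • ∫ s in (0 : ℝ)..r, Real.exp (-(r - s) / τ) • sqL2 (u (max s 0)).fn := by
  rw [h.eq_v r hr]
  congr 2
  refine intervalIntegral.integral_congr fun s hs => ?_
  rw [uIcc_of_le hr] at hs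
  simp only [max_eq_left hs.1]
  rfl

/-- The distance of `v(r)` to the adiabatic state `-|f|²`, up to the initial layer, if `u` stays
close to `f` on `[0, r]`. -/
theorem IsSDSolution.norm_relaxation_le {τ : ℝ} {u₀ : H1 ℂ} {v₀ : H1 ℝ} {u : ℝ → H1 ℂ}
    {v : ℝ → H1 ℝ} (h : IsSDSolution (-1) τ u₀ v₀ u v) (hτ : 0 < τ) {M : ℝ}
    (hM : ∀ s : ℝ, 0 ≤ s → ∀ᵐ x, ‖(u s).fn x‖ ≤ M) {r : ℝ} (hr : 0 ≤ r) {f : L2 ℂ} {q : ℝ}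
    (hf : ∀ᵐ x, ‖f x‖ ≤ q) (hMq : 0 ≤ M + q) {b c : ℝ} (hb : 0 ≤ b) (hc : 0 ≤ c)
    (hbc : ∀ s ∈ Icc 0 r, ‖(u s).fn - f‖ ≤ b + c * (r - s)) :
    ‖(v r).fn + sqL2 f - Real.exp (-r / τ) • (v₀.fn + sqL2 f)‖ ≤ (M + q) * (b + c * τ) := by
  have hQ : Continuous fun s => sqL2 (u (max s 0)).fn :=
    continuous_clamp (continuousOn_sqL2 h.continuousOn_u)
  have hcs : Continuous fun s => Real.exp (-(r - s) / τ) • sqL2 (u (max s 0)).fn := by fun_prop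
  have hce : Continuous fun s => Real.exp (-(r - s) / τ) • sqL2 f := by fun_prop
  have he : τ⁻¹ * ∫ s in (0 : ℝ)..r, Real.exp (-(r - s) / τ) = 1 - Real.exp (-r / τ) := by
    simpa using integral_relaxation_kernel hτ r 1 0
  have e1 : (v r).fn + sqL2 f - Real.exp (-r / τ) • (v₀.fn + sqL2 f)
      = -(τ⁻¹ • ∫ s in (0 : ℝ)..r,
          Real.exp (-(r - s) / τ) • (sqL2 (u (max s 0)).fn - sqL2 f)) := by
    simp only [smul_sub]
    rw [intervalIntegral.integral_sub (hcs.intervalIntegrable _ _) (hce.intervalIntegrable _ _),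
      intervalIntegral.integral_smul_const, h.v_fn_eq_integral hr, smul_sub, smul_smul, he,
      show (-1 : ℝ) / τ = -τ⁻¹ by rw [neg_div, one_div]]
    module
  rw [e1, norm_neg, norm_smul, norm_inv, Real.norm_of_nonneg hτ.le]
  have hi := integral_relaxation_kernel hτ r b c
  have h1 : ‖∫ s in (0 : ℝ)..r, Real.exp (-(r - s) / τ) • (sqL2 (u (max s 0)).fn - sqL2 f)‖
      ≤ ∫ s in (0 : ℝ)..r, (M + q) * (Real.exp (-(r - s) / τ) * (b + c * (r - s))) := by
    refine intervalIntegral.norm_integral_le_of_norm_le hr ?_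
      (Continuous.intervalIntegrable (by fun_prop) _ _)
    refine Eventually.of_forall fun s hs => ?_
    rw [norm_smul, Real.norm_of_nonneg (Real.exp_pos _).le, max_eq_left hs.1.le]
    have h2 := norm_sqL2_sub_le (hM s hs.1.le) hf
    have h3 := hbc s ⟨hs.1.le, hs.2⟩
    calc _ ≤ Real.exp (-(r - s) / τ) * ((M + q) * (b + c * (r - s))) := by
          gcongr
          exact h2.trans (by gcongr)
      _ = _ := by ring
  rw [intervalIntegral.integral_const_mul] at h1
  calc _ ≤ τ⁻¹ * ((M + q) * ∫ s in (0 : ℝ)..r, Real.exp (-(r - s) / τ) * (b + c * (r - s))) := by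
        gcongr
    _ = (M + q) * (τ⁻¹ * ∫ s in (0 : ℝ)..r, Real.exp (-(r - s) / τ) * (b + c * (r - s))) := by
        ring
    _ ≤ (M + q) * (b + c * τ) := by
        rw [hi]
        have : 0 ≤ Real.exp (-r / τ) * (b + c * τ + c * r) := by positivity
        gcongr
        linarith

/-- The difference of the nonlinear terms `u v` and `-|f|² f`. -/
theorem norm_toL2_sub_le {u : L2 ℂ} {v : H1 ℝ} {f : L2 ℂ} {M q : ℝ}
    (hu : ∀ᵐ x, ‖u x‖ ≤ M) (hf : ∀ᵐ x, ‖f x‖ ≤ q) :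
    ‖toL2 (fun x => u x * (v.fn x : ℂ)) - toL2 (fun x => ((-1 : ℝ) : ℂ) * (‖f x‖ : ℂ) ^ 2 * f x)‖
      ≤ M * ‖v.fn + sqL2 f‖ + q ^ 2 * ‖u - f‖ := by
  have hs : ∀ᵐ x, ‖ofRealL2 (sqL2 f) x‖ ≤ q ^ 2 := by
    filter_upwards [ofRealL2_coeFn (sqL2 f), sqL2_coeFn hf, hf] with x h1 h2 h3
    rw [h1, h2, Complex.norm_real, norm_pow, norm_norm]
    gcongr
  have e1 : toL2 (fun x => u x * (v.fn x : ℂ)) = mulL2 u (ofRealL2 v.fn) := by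
    refine toL2_congr ?_
    filter_upwards [ofRealL2_coeFn v.fn] with x hx
    rw [hx]
  have m2 : MemLp (fun x => ((-1 : ℝ) : ℂ) * (‖f x‖ : ℂ) ^ 2 * f x) 2 volume := by
    refine ((memLp_mul_of_bounded (g := f) hs).neg).ae_eq ?_
    filter_upwards [ofRealL2_coeFn (sqL2 f), sqL2_coeFn hf] with x h1 h2
    rw [Pi.neg_apply, h1, h2]
    push_cast
    ring
  have key : toL2 (fun x => u x * (v.fn x : ℂ))
      - toL2 (fun x => ((-1 : ℝ) : ℂ) * (‖f x‖ : ℂ) ^ 2 * f x)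
      = mulL2 u (ofRealL2 (v.fn + sqL2 f)) - mulL2 (ofRealL2 (sqL2 f)) (u - f) := by
    rw [e1]
    refine Lp.ext ?_
    filter_upwards [Lp.coeFn_sub (mulL2 u (ofRealL2 v.fn))
      (toL2 fun x => ((-1 : ℝ) : ℂ) * (‖f x‖ : ℂ) ^ 2 * f x),
      Lp.coeFn_sub (mulL2 u (ofRealL2 (v.fn + sqL2 f))) (mulL2 (ofRealL2 (sqL2 f)) (u - f)),
      mulL2_coeFn (g := ofRealL2 v.fn) hu, toL2_coeFn m2,
      mulL2_coeFn (g := ofRealL2 (v.fn + sqL2 f)) hu, mulL2_coeFn (g := u - f) hs,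
      ofRealL2_coeFn v.fn, ofRealL2_coeFn (sqL2 f), ofRealL2_coeFn (v.fn + sqL2 f),
      Lp.coeFn_add v.fn (sqL2 f), Lp.coeFn_sub u f, sqL2_coeFn hf]
      with x h1 h2 h3 h4 h5 h6 h7 h8 h9 h10 h11 h12
    rw [h1, h2, Pi.sub_apply, Pi.sub_apply, h3, h4, h5, h6, h7, h8, h9, h10, h11, Pi.add_apply,
      Pi.sub_apply, h12]
    push_cast
    ring
  rw [key]
  refine (norm_sub_le _ _).trans (add_le_add ?_ (norm_mulL2_le hs))
  have := norm_mulL2_le (g := ofRealL2 (v.fn + sqL2 f)) hu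
  rwa [norm_ofRealL2] at this

end Convergence

/-! ### The difference of the two solutions -/

noncomputable section Limit

/-- The estimate of the difference between a solution of the Schrödinger-Debye system and the
solution of the cubic equation. The unknown difference enters the right hand side through its
weighted maximum `A = sup e^{-Lt} ‖u'(t) - u(t)‖`, with coefficient at most `1/2`. -/
theorem IsSDSolution.norm_fn_sub_le {τ : ℝ} {u₀' : H1 ℂ} {v₀ : H1 ℝ} {u' : ℝ → H1 ℂ} {v : ℝ → H1 ℝ}
    (h : IsSDSolution (-1) τ u₀' v₀ u' v) (hτ : 0 < τ) {M C m δ c T L : ℝ} (hM0 : 0 ≤ M)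
    (hM : ∀ t : ℝ, 0 ≤ t → ∀ᵐ x, ‖(u' t).fn x‖ ≤ M) (hC : ‖v₀.fn‖ ≤ C) {u₀ : L2 ℂ}
    {u : ℝ → L2 ℂ} (hu : IsNLSSolution (-1) u₀ u) {q : ℝ → ℝ} (hq0 : ∀ t, 0 ≤ q t)
    (hq1 : IntegrableOn q (Icc 0 T))
    (hq : ∀ᵐ t ∂volume.restrict (Icc 0 T), ∀ᵐ x, ‖u t x‖ ≤ q t)
    (hm : ∀ t ∈ Icc 0 T, ‖u t‖ ≤ m) (hδ : 0 ≤ δ) (hc : 0 ≤ c)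
    (hmod : ∀ s ∈ Icc 0 T, ∀ r ∈ Icc 0 T, ‖u s - u r‖ ≤ δ + c * |r - s|) (hT : 0 ≤ T)
    (hL0 : 0 < L) (hk : IntegrableOn (fun s => M * (M + q s) + q s ^ 2) (Icc 0 T))
    (hL : ∀ t ∈ Icc 0 T,
      ∫ s in (0 : ℝ)..t, (M * (M + q s) + q s ^ 2) * Real.exp (-L * (t - s)) ≤ 1 / 2) :
    ∀ t ∈ Icc 0 T, ‖(u' t).fn - u t‖ ≤ 2 * Real.exp (L * T) * (‖u₀'.fn - u₀‖
      + (∫ r in Icc 0 T, Real.exp (-r / τ) * (M * (C + q r * m)))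
      + (δ + c * τ) * ∫ r in Icc 0 T, M * (M + q r)) := by
  have hC0 : 0 ≤ C := (norm_nonneg _).trans hC
  have hm0 : 0 ≤ m := (norm_nonneg _).trans (hm 0 ⟨le_rfl, hT⟩)
  set k : ℝ → ℝ := fun s => M * (M + q s) + q s ^ 2 with hkdef
  -- the weighted maximum `A` of the difference, attained at `t₀`
  have hac : ContinuousOn (fun t => ‖(u' t).fn - u t‖ * Real.exp (-L * t)) (Icc 0 T) := by
    have h1 := H1.continuous_fn.comp_continuousOn (h.continuousOn_u.mono
      (Icc_subset_Ici_self : Icc 0 T ⊆ Ici 0))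
    have h2 := hu.continuousOn.mono (Icc_subset_Ici_self : Icc 0 T ⊆ Ici 0)
    exact (h1.sub h2).norm.mul (by fun_prop)
  obtain ⟨t₀, ht₀, hmax⟩ := isCompact_Icc.exists_isMaxOn (nonempty_Icc.2 hT) hac
  set A := ‖(u' t₀).fn - u t₀‖ * Real.exp (-L * t₀) with hA
  have hA0 : 0 ≤ A := by positivity
  have ha : ∀ t ∈ Icc 0 T, ‖(u' t).fn - u t‖ ≤ A * Real.exp (L * t) := by
    intro t ht
    have h1 : ‖(u' t).fn - u t‖ * Real.exp (-L * t) ≤ A := hmax ht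
    have h2 : Real.exp (-L * t) * Real.exp (L * t) = 1 := by
      rw [← Real.exp_add]; simp
    calc _ = ‖(u' t).fn - u t‖ * Real.exp (-L * t) * Real.exp (L * t) := by
          rw [mul_assoc, h2, mul_one]
      _ ≤ _ := by gcongr
  -- The difference `D` of the nonlinear terms is at most the sum of the initial layer `g₁`, the
  -- error `(δ + c τ) g₂` of freezing `u` over the memory of the relaxation, and the feedback
  -- of `A`.
  set g₁ : ℝ → ℝ := fun r => Real.exp (-r / τ) * (M * (C + q r * m)) with hg₁
  set g₂ : ℝ → ℝ := fun r => M * (M + q r) with hg₂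
  set D : ℝ → L2 ℂ := fun s => toL2 (fun x => (u' s).fn x * ((v s).fn x : ℂ))
    - toL2 (fun x => ((-1 : ℝ) : ℂ) * (‖u s x‖ : ℂ) ^ 2 * u s x) with hD
  have hDle : ∀ᵐ r ∂volume.restrict (Icc 0 T), ‖D r‖
      ≤ g₁ r + (δ + c * τ) * g₂ r + A * (k r * Real.exp (L * r)) := by
    filter_upwards [hq, ae_restrict_mem measurableSet_Icc] with r hqr hr
    have h1 := norm_toL2_sub_le (v := v r) (hM r hr.1) hqr
    have hb : 0 ≤ δ + A * Real.exp (L * r) := by positivity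
    have h2 := h.norm_relaxation_le hτ hM hr.1 hqr (add_nonneg hM0 (hq0 r)) hb hc
      (fun s hs => by
        have hsT : s ∈ Icc 0 T := ⟨hs.1, hs.2.trans hr.2⟩
        have e1 := ha s hsT
        have e2 := hmod s hsT r hr
        rw [abs_of_nonneg (sub_nonneg.2 hs.2)] at e2
        have e3 : A * Real.exp (L * s) ≤ A * Real.exp (L * r) := by
          have := hs.2
          gcongr
        have e4 : (u' s).fn - u r = ((u' s).fn - u s) + (u s - u r) := by abel
        rw [e4]
        linarith [norm_add_le ((u' s).fn - u s) (u s - u r)])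
    have h3 : ‖Real.exp (-r / τ) • (v₀.fn + sqL2 (u r))‖
        ≤ Real.exp (-r / τ) * (C + q r * m) := by
      rw [norm_smul, Real.norm_of_nonneg (Real.exp_pos _).le]
      gcongr
      refine (norm_add_le _ _).trans (add_le_add hC ((norm_sqL2_le hqr).trans ?_))
      exact mul_le_mul_of_nonneg_left (hm r hr) (hq0 r)
    have h4 : ‖(v r).fn + sqL2 (u r)‖ ≤ (M + q r) * (δ + A * Real.exp (L * r) + c * τ)
        + Real.exp (-r / τ) * (C + q r * m) := by
      have e : (v r).fn + sqL2 (u r) = ((v r).fn + sqL2 (u r)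
          - Real.exp (-r / τ) • (v₀.fn + sqL2 (u r)))
          + Real.exp (-r / τ) • (v₀.fn + sqL2 (u r)) := by abel
      rw [e]
      exact (norm_add_le _ _).trans (add_le_add h2 h3)
    have h5 := mul_le_mul_of_nonneg_left h4 hM0
    have h6 := mul_le_mul_of_nonneg_left (ha r hr) (sq_nonneg (q r))
    refine h1.trans ((add_le_add h5 h6).trans (le_of_eq ?_))
    simp only [hg₁, hg₂, hkdef]
    ring
  have hkL : IntegrableOn (fun r => k r * Real.exp (L * r)) (Icc 0 T) :=
    hk.mul_continuousOn (by fun_prop) isCompact_Icc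
  have hqc : IntegrableOn (fun r => M * (C + q r * m)) (Icc 0 T) :=
    (((integrableOn_const (by simp)).add (hq1.mul_const m)).const_mul M)
  have hg₁i : IntegrableOn g₁ (Icc 0 T) :=
    hqc.continuousOn_mul (g := fun r => Real.exp (-r / τ)) (by fun_prop) isCompact_Icc
  have hg₂i : IntegrableOn g₂ (Icc 0 T) :=
    ((integrableOn_const (by simp)).add hq1).const_mul M
  have hsub : Ioc 0 t₀ ⊆ Icc 0 T := fun s hs => ⟨hs.1.le, hs.2.trans ht₀.2⟩
  have hii : ∀ {f : ℝ → ℝ}, IntegrableOn f (Icc 0 T) → IntervalIntegrable f volume 0 t₀ :=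
    fun hf => (intervalIntegrable_iff_integrableOn_Ioc_of_le ht₀.1).2 (hf.mono_set hsub)
  have hle : ∀ {f : ℝ → ℝ}, IntegrableOn f (Icc 0 T) → (∀ s, 0 ≤ f s) →
      ∫ s in (0 : ℝ)..t₀, f s ≤ ∫ s in Icc 0 T, f s := fun hf h0 => by
    rw [intervalIntegral.integral_of_le ht₀.1]
    exact setIntegral_mono_set hf (Eventually.of_forall h0) hsub.eventuallyLE
  -- Duhamel's formula for the difference, at the time `t₀` of the maximum
  have hdiff : (u' t₀).fn - u t₀ = schrodingerGroup t₀ (u₀'.fn - u₀)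
      - Complex.I • ∫ s in (0 : ℝ)..t₀, schrodingerGroup (t₀ - s) (D s) := by
    have i1 : IntervalIntegrable (fun s => schrodingerGroup (t₀ - s)
        (toL2 fun x => (u' s).fn x * ((v s).fn x : ℂ))) volume 0 t₀ := by
      have hc : Continuous fun s =>
          schrodingerGroup (t₀ - s) (coupling (u' (max s 0)) (v (max s 0))) :=
        continuous_schrodingerGroup (continuous_const.sub continuous_id) h.continuous_source
      refine (hc.intervalIntegrable 0 t₀).congr fun s hs => ?_
      rw [uIoc_of_le ht₀.1] at hs
      simp only [toL2_eq_coupling, max_eq_left hs.1.le]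
    have i2 := hu.intervalIntegrable t₀ ht₀.1
    simp only [hD, schrodingerGroup_sub_right]
    rw [intervalIntegral.integral_sub i1 i2, h.eq_u t₀ ht₀.1, hu.eq_u t₀ ht₀.1, smul_sub]
    abel
  have hint : ‖∫ s in (0 : ℝ)..t₀, schrodingerGroup (t₀ - s) (D s)‖
      ≤ ∫ s in (0 : ℝ)..t₀, (g₁ s + (δ + c * τ) * g₂ s + A * (k s * Real.exp (L * s))) := by
    refine intervalIntegral.norm_integral_le_of_norm_le ht₀.1 ?_
      (((hii hg₁i).add ((hii hg₂i).const_mul _)).add ((hii hkL).const_mul _))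
    filter_upwards [(ae_restrict_iff' measurableSet_Icc).1 hDle] with s hs hs0
    rw [norm_schrodingerGroup]
    exact hs (hsub hs0)
  have hsum : ∫ s in (0 : ℝ)..t₀, (g₁ s + (δ + c * τ) * g₂ s + A * (k s * Real.exp (L * s)))
      = (∫ s in (0 : ℝ)..t₀, g₁ s) + (δ + c * τ) * (∫ s in (0 : ℝ)..t₀, g₂ s)
        + A * ∫ s in (0 : ℝ)..t₀, k s * Real.exp (L * s) := by
    rw [intervalIntegral.integral_add ((hii hg₁i).add ((hii hg₂i).const_mul _))
      ((hii hkL).const_mul _), intervalIntegral.integral_add (hii hg₁i) ((hii hg₂i).const_mul _),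
      intervalIntegral.integral_const_mul (δ + c * τ), intervalIntegral.integral_const_mul A]
  have hkey : A * ∫ s in (0 : ℝ)..t₀, k s * Real.exp (L * s)
      ≤ A * (Real.exp (L * t₀) * (1 / 2)) := by
    have e : ∀ s, k s * Real.exp (L * s)
        = Real.exp (L * t₀) * (k s * Real.exp (-L * (t₀ - s))) := fun s => by
      rw [mul_left_comm, ← Real.exp_add]
      congr 2
      ring
    simp_rw [e]
    rw [intervalIntegral.integral_const_mul]
    have := hL t₀ ht₀
    gcongr
  have hG₁ := hle hg₁i fun s => by
    have := hq0 s
    positivity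
  have hG₂ := hle hg₂i fun s => by
    have := hq0 s
    positivity
  set E := ‖u₀'.fn - u₀‖ + (∫ r in Icc 0 T, g₁ r) + (δ + c * τ) * ∫ r in Icc 0 T, g₂ r with hE
  have hAt : ‖(u' t₀).fn - u t₀‖ = A * Real.exp (L * t₀) := by
    rw [hA, mul_assoc, ← Real.exp_add]
    simp
  have hfin : ‖(u' t₀).fn - u t₀‖ ≤ E + A * (Real.exp (L * t₀) * (1 / 2)) := by
    rw [hdiff]
    refine (norm_sub_le _ _).trans ?_
    rw [norm_smul, Complex.norm_I, one_mul, norm_schrodingerGroup]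
    have h1 : (δ + c * τ) * (∫ s in (0 : ℝ)..t₀, g₂ s) ≤ (δ + c * τ) * ∫ r in Icc 0 T, g₂ r := by
      have : 0 ≤ δ + c * τ := by positivity
      gcongr
    rw [hsum] at hint
    linarith
  -- the feedback is absorbed: `e^{L t₀} A ≤ E + e^{L t₀} A / 2`
  have hA2 : A ≤ 2 * E := by
    have h1 : 1 ≤ Real.exp (L * t₀) := Real.one_le_exp (mul_nonneg hL0.le ht₀.1)
    nlinarith
  intro t ht
  refine (ha t ht).trans ?_
  have h1 : Real.exp (L * t) ≤ Real.exp (L * T) := by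
    have := ht.2
    gcongr
  calc A * Real.exp (L * t) ≤ 2 * E * Real.exp (L * T) :=
        mul_le_mul hA2 h1 (Real.exp_pos _).le (hA0.trans hA2)
    _ = _ := by ring

theorem tendsto_exp_neg_div_nhdsGT {r : ℝ} (hr : 0 < r) :
    Tendsto (fun τ : ℝ => Real.exp (-r / τ)) (𝓝[>] 0) (𝓝 0) := by
  refine Real.tendsto_exp_atBot.comp ?_
  exact (tendsto_inv_nhdsGT_zero (𝕜 := ℝ)).const_mul_atTop_of_neg (neg_neg_of_pos hr)

/-- The initial layer is negligible in the mean. -/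
theorem tendsto_integral_exp_neg_div_mul {f : ℝ → ℝ} {T : ℝ} (hf : IntegrableOn f (Icc 0 T)) :
    Tendsto (fun τ : ℝ => ∫ r in Icc 0 T, Real.exp (-r / τ) * f r) (𝓝[>] 0) (𝓝 0) := by
  suffices h : Tendsto (fun τ : ℝ => ∫ r in Icc 0 T, Real.exp (-r / τ) * f r) (𝓝[>] 0)
      (𝓝 (∫ r in Icc 0 T, (0 : ℝ))) by simpa only [integral_zero] using h
  refine tendsto_integral_filter_of_dominated_convergence (fun r => ‖f r‖)
    (Eventually.of_forall fun τ => ?_) ?_ hf.norm ?_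
  · exact (Continuous.aestronglyMeasurable (by fun_prop)).mul hf.aestronglyMeasurable
  · filter_upwards [self_mem_nhdsWithin] with τ hτ
    filter_upwards [ae_restrict_mem measurableSet_Icc] with r hr
    rw [norm_mul, Real.norm_of_nonneg (Real.exp_pos _).le]
    refine mul_le_of_le_one_left (norm_nonneg _) (Real.exp_le_one_iff.2 ?_)
    exact div_nonpos_of_nonpos_of_nonneg (neg_nonpos.2 hr.1) (le_of_lt hτ)
  · have h0 : ∀ᵐ r ∂volume.restrict (Icc 0 T), r ≠ (0 : ℝ) :=
      ae_restrict_of_ae (Measure.ae_ne volume 0)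
    filter_upwards [ae_restrict_mem measurableSet_Icc, h0] with r hr hr0
    simpa using (tendsto_exp_neg_div_nhdsGT (lt_of_le_of_ne hr.1 hr0.symm)).mul_const (f r)

theorem eLpNorm_le_ofReal {𝕜 : Type} [RCLike 𝕜] {F : ℝ → 𝕜} {f : L2 𝕜}
    (h : ∀ᵐ x, F x = f x) {ε : ℝ} (hf : ‖f‖ ≤ ε) : eLpNorm F 2 volume ≤ ENNReal.ofReal ε := by
  rw [eLpNorm_congr_ae h, ← ENNReal.ofReal_toReal (Lp.eLpNorm_ne_top f), ← Lp.norm_def]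
  exact ENNReal.ofReal_le_ofReal hf

/-- Uniform estimates in `L²` give convergence of the `[0, ∞]`-valued norm. -/
theorem tendsto_normLinftyL2 {𝕜 : Type} [RCLike 𝕜] {l : Filter ℝ} {T : ℝ} {F : ℝ → ℝ → ℝ → 𝕜}
    (h : ∀ ε : ℝ, 0 < ε → ∀ᶠ τ in l, ∀ t ∈ Icc 0 T, eLpNorm (F τ t) 2 volume ≤ ENNReal.ofReal ε) :
    Tendsto (fun τ => normLinftyL2 T (F τ)) l (𝓝 0) := by
  rw [ENNReal.tendsto_nhds_zero]
  intro ε hε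
  by_cases ht : ε = ⊤
  · simp [ht]
  · filter_upwards [h ε.toReal (ENNReal.toReal_pos hε.ne' ht)] with τ hτ
    rw [ENNReal.ofReal_toReal ht] at hτ
    exact iSup₂_le hτ

end Limit

/-! ### Convergence as the relaxation time tends to zero -/

/-- Both hypotheses on the data `v₀τ` amount to boundedness in `L²` for small `τ`. -/
theorem exists_eventually_norm_fn_le {u₀τ : ℝ → H1 ℂ} {v₀τ : ℝ → H1 ℝ} {R : ℝ}
    (hR : ∀ᶠ τ in 𝓝[>] (0 : ℝ), ‖u₀τ τ‖ ≤ R)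
    (h : (∃ C : ℝ, ∀ τ ∈ Ioo (0 : ℝ) 1, ‖(v₀τ τ).fn‖ ≤ C) ∨
      ∀ τ ∈ Ioo (0 : ℝ) 1, sdEnergy (-1) (u₀τ τ) (v₀τ τ) ≤ 0) :
    ∃ C : ℝ, ∀ᶠ τ in 𝓝[>] (0 : ℝ), ‖(v₀τ τ).fn‖ ≤ C := by
  have hI : ∀ᶠ τ in 𝓝[>] (0 : ℝ), τ ∈ Ioo (0 : ℝ) 1 := Ioo_mem_nhdsGT one_pos
  rcases h with ⟨C, hC⟩ | hE
  · exact ⟨C, hI.mono hC⟩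
  -- a nonpositive energy bounds `v₀τ` by itself
  · refine ⟨√(16 * (R ^ 2 + 1) * (R ^ 2) ^ 2), ?_⟩
    filter_upwards [hI, hR] with τ hτ hRτ
    exact norm_fn_le_of_sdEnergy_nonpos hRτ (hE τ hτ)

/-- The convergence of `u_τ`, for data `v₀τ` bounded in `L²`, from a uniform bound of `u_τ`. -/
theorem eventually_norm_fn_sub_le {u₀τ : ℝ → H1 ℂ} {v₀τ : ℝ → H1 ℝ} {u₀ : H1 ℂ}
    (h₀ : Tendsto (fun τ => ‖u₀τ τ - u₀‖) (𝓝[>] 0) (𝓝 0)) {uτ : ℝ → ℝ → H1 ℂ}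
    {vτ : ℝ → ℝ → H1 ℝ} (hSD : ∀ τ ∈ Ioo (0 : ℝ) 1,
      IsSDSolution (-1) τ (u₀τ τ) (v₀τ τ) (uτ τ) (vτ τ))
    {u : ℝ → L2 ℂ} (hNLS : IsNLSSolution (-1) u₀.fn u) {T : ℝ} (hT : 0 < T) {C M : ℝ}
    (hC : ∀ᶠ τ in 𝓝[>] (0 : ℝ), ‖(v₀τ τ).fn‖ ≤ C) (hM0 : 0 ≤ M)
    (hM : ∀ᶠ τ in 𝓝[>] (0 : ℝ), ∀ t : ℝ, 0 ≤ t → ∀ᵐ x, ‖(uτ τ t).fn x‖ ≤ M)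
    {ε : ℝ} (hε : 0 < ε) :
    ∀ᶠ τ in 𝓝[>] (0 : ℝ), ∀ t ∈ Icc 0 T, ‖(uτ τ t).fn - u t‖ ≤ ε := by
  have hI : ∀ᶠ τ in 𝓝[>] (0 : ℝ), τ ∈ Ioo (0 : ℝ) 1 := Ioo_mem_nhdsGT one_pos
  have huc : ContinuousOn u (Icc 0 T) := hNLS.continuousOn.mono Icc_subset_Ici_self
  obtain ⟨m, hm⟩ := isCompact_Icc.exists_bound_of_continuousOn huc
  obtain ⟨q, hq0, hq1, hq2, hq⟩ := hNLS.exists_bound T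
  have hk₁ : IntegrableOn (fun s => M * (M + q s)) (Icc 0 T) :=
    ((integrableOn_const (by simp)).add hq1).const_mul M
  have hk : IntegrableOn (fun s => M * (M + q s) + q s ^ 2) (Icc 0 T) := hk₁.add hq2
  obtain ⟨L, hL0, hL⟩ := exists_integral_mul_exp_le (fun s => by
    have := hq0 s
    positivity) hk
  set K := ∫ r in Icc 0 T, M * (M + q r)
  have hK : 0 ≤ K := setIntegral_nonneg measurableSet_Icc fun s _ => by
    have := hq0 s
    positivity
  -- `δ` keeps the part of the estimate that does not vanish with `τ` below `ε / 2`
  set δ := ε / (4 * Real.exp (L * T) * (K + 1)) with hδdef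
  have hδ : 0 < δ := by positivity
  obtain ⟨c, hc, hmod⟩ := exists_norm_sub_le_add_mul huc hδ
  have hqc : IntegrableOn (fun r => M * (C + q r * m)) (Icc 0 T) :=
    ((integrableOn_const (by simp)).add (hq1.mul_const m)).const_mul M
  have hlayer := tendsto_integral_exp_neg_div_mul hqc
  have hτ0 : Tendsto (fun τ : ℝ => τ) (𝓝[>] 0) (𝓝 0) := nhdsWithin_le_nhds
  have hlim : Tendsto (fun τ : ℝ => 2 * Real.exp (L * T) * (‖u₀τ τ - u₀‖
      + (∫ r in Icc 0 T, Real.exp (-r / τ) * (M * (C + q r * m))) + (δ + c * τ) * K))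
      (𝓝[>] 0) (𝓝 (2 * Real.exp (L * T) * (0 + 0 + (δ + c * 0) * K))) :=
    ((h₀.add hlayer).add (((hτ0.const_mul c).const_add δ).mul_const K)).const_mul _
  have hlt : 2 * Real.exp (L * T) * (0 + 0 + (δ + c * 0) * K) < ε := by
    have e : 2 * Real.exp (L * T) * (0 + 0 + (δ + c * 0) * K) = ε * (K / (2 * (K + 1))) := by
      rw [hδdef]
      have := Real.exp_pos (L * T)
      field_simp
      ring
    rw [e]
    have : K / (2 * (K + 1)) < 1 := by
      rw [div_lt_one (by positivity)]
      linarith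
    nlinarith
  filter_upwards [hI, hC, hM, hlim.eventually_lt_const hlt] with τ hτ hCτ hMτ hlimτ t ht
  refine ((hSD τ hτ).norm_fn_sub_le hτ.1 hM0 hMτ hCτ hNLS hq0 hq1 hq hm hδ.le hc hmod hT.le hL0
    hk hL t ht).trans (le_trans ?_ hlimτ.le)
  have : ‖(u₀τ τ).fn - u₀.fn‖ ≤ ‖u₀τ τ - u₀‖ := H1.norm_fn_le (u₀τ τ - u₀)
  gcongr

/-- The convergence of `v_τ` up to the initial layer, from that of `u_τ`. -/
theorem eventually_norm_relaxation_le {u₀τ : ℝ → H1 ℂ} {v₀τ : ℝ → H1 ℝ} {u₀ : H1 ℂ}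
    {uτ : ℝ → ℝ → H1 ℂ}
    {vτ : ℝ → ℝ → H1 ℝ} (hSD : ∀ τ ∈ Ioo (0 : ℝ) 1,
      IsSDSolution (-1) τ (u₀τ τ) (v₀τ τ) (uτ τ) (vτ τ))
    {u : ℝ → L2 ℂ} (hNLS : IsNLSSolution (-1) u₀.fn u) {T : ℝ} (hT : 0 < T) {M : ℝ}
    (hM0 : 0 ≤ M) (hM : ∀ᶠ τ in 𝓝[>] (0 : ℝ), ∀ t : ℝ, 0 ≤ t → ∀ᵐ x, ‖(uτ τ t).fn x‖ ≤ M)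
    (hMu : ∀ t ∈ Icc 0 T, ∀ᵐ x, ‖u t x‖ ≤ M)
    (hconv : ∀ ε : ℝ, 0 < ε → ∀ᶠ τ in 𝓝[>] (0 : ℝ), ∀ t ∈ Icc 0 T, ‖(uτ τ t).fn - u t‖ ≤ ε)
    {ε : ℝ} (hε : 0 < ε) :
    ∀ᶠ τ in 𝓝[>] (0 : ℝ), ∀ t ∈ Icc 0 T, ‖(vτ τ t).fn + sqL2 (u t)
      - Real.exp (-t / τ) • ((v₀τ τ).fn + sqL2 u₀.fn)‖ ≤ ε := by
  have hI : ∀ᶠ τ in 𝓝[>] (0 : ℝ), τ ∈ Ioo (0 : ℝ) 1 := Ioo_mem_nhdsGT one_pos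
  have huc : ContinuousOn u (Icc 0 T) := hNLS.continuousOn.mono Icc_subset_Ici_self
  have h0 : u 0 = u₀.fn := by
    simpa [schrodingerGroup_zero] using hNLS.eq_u 0 le_rfl
  have h0T : (0 : ℝ) ∈ Icc 0 T := ⟨le_rfl, hT.le⟩
  -- the terms with `δ` below add up to at most `6 M δ`, and those with `c τ` to `4 M c τ`
  set δ := ε / (8 * (M + 1)) with hδdef
  have hδ : 0 < δ := by positivity
  have hMδ : 8 * (M * δ) ≤ ε := by
    have : 8 * (M * δ) = ε * (M / (M + 1)) := by
      rw [hδdef]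
      field_simp
    rw [this]
    exact mul_le_of_le_one_right hε.le (div_le_one_of_le₀ (by linarith) (by positivity))
  obtain ⟨c, hc, hmod⟩ := exists_norm_sub_le_add_mul huc hδ
  have hτ0 : Tendsto (fun τ : ℝ => 4 * (M * (c * τ))) (𝓝[>] 0) (𝓝 (4 * (M * (c * 0)))) :=
    (((tendsto_id.mono_left nhdsWithin_le_nhds).const_mul c).const_mul M).const_mul 4
  have hsmall : ∀ᶠ τ in 𝓝[>] (0 : ℝ), 4 * (M * (c * τ)) < ε / 4 :=
    hτ0.eventually_lt_const (by rw [mul_zero, mul_zero, mul_zero]; positivity)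
  filter_upwards [hI, hM, hconv δ hδ, hsmall] with τ hτ hMτ hδτ hsτ t ht
  have h1 := (hSD τ hτ).norm_relaxation_le hτ.1 hMτ ht.1 (hMu t ht) (add_nonneg hM0 hM0)
    (b := δ + δ) (by positivity) hc (fun s hs => by
      have hsT : s ∈ Icc 0 T := ⟨hs.1, hs.2.trans ht.2⟩
      have e1 := hδτ s hsT
      have e2 := hmod s hsT t ht
      rw [abs_of_nonneg (sub_nonneg.2 hs.2)] at e2
      have e4 : (uτ τ s).fn - u t = ((uτ τ s).fn - u s) + (u s - u t) := by abel
      rw [e4]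
      linarith [norm_add_le ((uτ τ s).fn - u s) (u s - u t)])
  have h2 : ‖Real.exp (-t / τ) • (sqL2 (u t) - sqL2 u₀.fn)‖ ≤ (M + M) * (δ + c * τ) := by
    have e1 := norm_sqL2_sub_le (hMu t ht) (hMu 0 h0T)
    have e2 := hmod t ht 0 h0T
    rw [zero_sub, abs_neg, abs_of_nonneg ht.1] at e2
    rw [norm_smul, Real.norm_of_nonneg (Real.exp_pos _).le, ← h0]
    have e3 : Real.exp (-t / τ) ≤ 1 := Real.exp_le_one_iff.2
      (div_nonpos_of_nonpos_of_nonneg (neg_nonpos.2 ht.1) hτ.1.le)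
    have e4 : Real.exp (-t / τ) * t ≤ τ := by
      have e5 := Real.add_one_le_exp (t / τ)
      have e6 : Real.exp (-t / τ) * Real.exp (t / τ) = 1 := by
        rw [← Real.exp_add, neg_div, neg_add_cancel, Real.exp_zero]
      have e7 : t = τ * (t / τ) := by field_simp [hτ.1.ne']
      have e8 : Real.exp (-t / τ) * (t / τ) ≤ 1 := by
        rw [← e6]
        have := Real.exp_pos (-t / τ)
        gcongr
        linarith
      calc Real.exp (-t / τ) * t = τ * (Real.exp (-t / τ) * (t / τ)) := by
            rw [mul_left_comm, ← e7]
        _ ≤ τ * 1 := mul_le_mul_of_nonneg_left e8 hτ.1.le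
        _ = τ := mul_one τ
    calc _ ≤ Real.exp (-t / τ) * ((M + M) * (δ + c * t)) := by
          gcongr
          exact e1.trans (by gcongr)
      _ = (M + M) * (Real.exp (-t / τ) * δ + c * (Real.exp (-t / τ) * t)) := by ring
      _ ≤ (M + M) * (1 * δ + c * τ) := by gcongr
      _ = _ := by ring
  have e : (vτ τ t).fn + sqL2 (u t) - Real.exp (-t / τ) • ((v₀τ τ).fn + sqL2 u₀.fn)
      = ((vτ τ t).fn + sqL2 (u t) - Real.exp (-t / τ) • ((v₀τ τ).fn + sqL2 (u t)))
        + Real.exp (-t / τ) • (sqL2 (u t) - sqL2 u₀.fn) := by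
    module
  rw [e]
  refine (norm_add_le _ _).trans ((add_le_add h1 h2).trans ?_)
  nlinarith

theorem theorem1p4
    -- data of the Schrödinger-Debye system, for each `τ`
    (u₀τ : ℝ → H1 ℂ) (v₀τ : ℝ → H1 ℝ)
    -- limit datum
    (u₀ : H1 ℂ)
    (h_i : Tendsto (fun τ => ‖u₀τ τ - u₀‖) (𝓝[>] 0) (𝓝 0))
    (h_ii_or_iii :
      (∃ C : ℝ, ∀ τ ∈ Ioo (0 : ℝ) 1, ‖(v₀τ τ).fn‖ ≤ C) ∨
      ((∃ γ : ℝ, 0 < γ ∧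
          (fun τ => ‖(v₀τ τ).fn‖) =O[𝓝[>] 0] (fun τ : ℝ => τ ^ (-1 + γ))) ∧
        ∀ τ ∈ Ioo (0 : ℝ) 1, sdEnergy (-1) (u₀τ τ) (v₀τ τ) ≤ 0))
    -- the solutions, as functions of `τ` and `t`
    (uτ : ℝ → ℝ → H1 ℂ) (vτ : ℝ → ℝ → H1 ℝ)
    (hSD : ∀ τ ∈ Ioo (0 : ℝ) 1, IsSDSolution (-1) τ (u₀τ τ) (v₀τ τ) (uτ τ) (vτ τ))
    (u : ℝ → L2 ℂ) (hNLS : IsNLSSolution (-1) u₀.fn u)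
    (T : ℝ) (hT : 0 < T) :
    Tendsto (fun τ => normLinftyL2 T fun t x => (uτ τ t).fn x - u t x) (𝓝[>] 0) (𝓝 0) ∧
    Tendsto (fun τ => normLinftyL2 T fun t x => (vτ τ t).fn x + ‖u t x‖ ^ 2
        - Real.exp (-t / τ) * ((v₀τ τ).fn x + ‖u₀.fn x‖ ^ 2)) (𝓝[>] 0) (𝓝 0) ∧
    (Tendsto (fun τ => eLpNorm (fun x => (v₀τ τ).fn x + ‖u₀.fn x‖ ^ 2) 2 volume)
        (𝓝[>] 0) (𝓝 0) →
      Tendsto (fun τ => normLinftyL2 T fun t x => (vτ τ t).fn x + ‖u t x‖ ^ 2)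
        (𝓝[>] 0) (𝓝 0)) := by
  have hI : ∀ᶠ τ in 𝓝[>] (0 : ℝ), τ ∈ Ioo (0 : ℝ) 1 := Ioo_mem_nhdsGT one_pos
  have hR : ∀ᶠ τ in 𝓝[>] (0 : ℝ), ‖u₀τ τ‖ ≤ ‖u₀‖ + 1 := by
    filter_upwards [h_i.eventually_le_const one_pos] with τ hτ
    linarith [norm_le_norm_add_norm_sub' (u₀τ τ) u₀]
  obtain ⟨C, hC⟩ := exists_eventually_norm_fn_le hR (h_ii_or_iii.imp id And.right)
  obtain ⟨M, hM0, hMall⟩ := exists_forall_isSDSolution_ae_norm_le (‖u₀‖ + 1) C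
  have hM : ∀ᶠ τ in 𝓝[>] (0 : ℝ), ∀ t : ℝ, 0 ≤ t → ∀ᵐ x, ‖(uτ τ t).fn x‖ ≤ M := by
    filter_upwards [hI, hR, hC] with τ hτ hRτ hCτ
    exact hMall τ _ _ _ _ hτ.1 (hSD τ hτ) hRτ hCτ
  have hconv : ∀ ε : ℝ, 0 < ε → ∀ᶠ τ in 𝓝[>] (0 : ℝ), ∀ t ∈ Icc 0 T, ‖(uτ τ t).fn - u t‖ ≤ ε :=
    fun ε hε => eventually_norm_fn_sub_le h_i hSD hNLS hT hC hM0 hM hε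
  -- the uniform bound passes to the limit `u`, at every time
  have hMu : ∀ t ∈ Icc 0 T, ∀ᵐ x, ‖u t x‖ ≤ M := by
    intro t ht
    have hlim : Tendsto (fun τ => (uτ τ t).fn) (𝓝[>] 0) (𝓝 (u t)) := by
      rw [Metric.tendsto_nhds]
      intro ε hε
      filter_upwards [hconv (ε / 2) (half_pos hε)] with τ hτ
      rw [dist_eq_norm]
      linarith [hτ t ht]
    exact (isClosed_setOf_ae_norm_le M).mem_of_tendsto hlim (hM.mono fun τ hτ => hτ t ht.1)
  have hrel : ∀ ε : ℝ, 0 < ε → ∀ᶠ τ in 𝓝[>] (0 : ℝ), ∀ t ∈ Icc 0 T, ‖(vτ τ t).fn + sqL2 (u t)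
      - Real.exp (-t / τ) • ((v₀τ τ).fn + sqL2 u₀.fn)‖ ≤ ε :=
    fun ε hε => eventually_norm_relaxation_le hSD hNLS hT hM0 hM hMu hconv hε
  have hsq0 := sqL2_coeFn u₀.ae_norm_le
  refine ⟨tendsto_normLinftyL2 fun ε hε => ?_, tendsto_normLinftyL2 fun ε hε => ?_,
    fun hlay => tendsto_normLinftyL2 fun ε hε => ?_⟩
  · filter_upwards [hconv ε hε] with τ hτ t ht
    refine eLpNorm_le_ofReal ?_ (hτ t ht)
    filter_upwards [Lp.coeFn_sub (uτ τ t).fn (u t)] with x hx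
    rw [hx, Pi.sub_apply]
  · filter_upwards [hrel ε hε] with τ hτ t ht
    refine eLpNorm_le_ofReal ?_ (hτ t ht)
    filter_upwards [Lp.coeFn_sub ((vτ τ t).fn + sqL2 (u t))
      (Real.exp (-t / τ) • ((v₀τ τ).fn + sqL2 u₀.fn)), Lp.coeFn_add (vτ τ t).fn (sqL2 (u t)),
      Lp.coeFn_smul (Real.exp (-t / τ)) ((v₀τ τ).fn + sqL2 u₀.fn),
      Lp.coeFn_add (v₀τ τ).fn (sqL2 u₀.fn), sqL2_coeFn (hMu t ht), hsq0] with x h1 h2 h3 h4 h5 h6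
    rw [h1, Pi.sub_apply, h2, h3, Pi.smul_apply, h4, Pi.add_apply, Pi.add_apply, h5, h6,
      smul_eq_mul]
  · have hlay' : ∀ᶠ τ in 𝓝[>] (0 : ℝ), ‖(v₀τ τ).fn + sqL2 u₀.fn‖ ≤ ε / 2 := by
      have h1 := (ENNReal.tendsto_nhds_zero.1 hlay) (ENNReal.ofReal (ε / 2)) (by simpa using hε)
      filter_upwards [h1] with τ hτ
      rw [Lp.norm_def]
      refine ENNReal.toReal_le_of_le_ofReal (by positivity) (le_trans (le_of_eq ?_) hτ)
      refine eLpNorm_congr_ae ?_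
      filter_upwards [Lp.coeFn_add (v₀τ τ).fn (sqL2 u₀.fn), hsq0] with x h4 h6
      rw [h4, Pi.add_apply, h6]
    filter_upwards [hrel (ε / 2) (half_pos hε), hlay', hI] with τ hτ hτl hτI t ht
    refine eLpNorm_le_ofReal (f := (vτ τ t).fn + sqL2 (u t)) ?_ ?_
    · filter_upwards [Lp.coeFn_add (vτ τ t).fn (sqL2 (u t)), sqL2_coeFn (hMu t ht)] with x h2 h5
      rw [h2, Pi.add_apply, h5]
    · have e : (vτ τ t).fn + sqL2 (u t) = ((vτ τ t).fn + sqL2 (u t)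
          - Real.exp (-t / τ) • ((v₀τ τ).fn + sqL2 u₀.fn))
          + Real.exp (-t / τ) • ((v₀τ τ).fn + sqL2 u₀.fn) := by abel
      have h2 : ‖Real.exp (-t / τ) • ((v₀τ τ).fn + sqL2 u₀.fn)‖ ≤ ε / 2 := by
        rw [norm_smul, Real.norm_of_nonneg (Real.exp_pos _).le]
        refine (mul_le_of_le_one_left (norm_nonneg _) (Real.exp_le_one_iff.2 ?_)).trans hτl
        exact div_nonpos_of_nonpos_of_nonneg (neg_nonpos.2 ht.1) hτI.1.le
      rw [e]
      exact (norm_add_le _ _).trans (by linarith [hτ t ht])
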